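/- Let $(\Omega,\mathcal F,\mathbb P)$ be a nonatomic probability space (every event of positive probability contains an event of positive, strictly smaller probability), fix $p\in[1,\infty]$, and let $L^p=L^p(\Omega,\mathcal F,\mathbb P)$, with random variables identified when they are a.s. equal. Let $\succeq$ be a preference on $L^p$, i.e. a total preorder, with strict part $\succ$ and symmetric part $\simeq$. Write $X\le_{\rm cx}Y$ if $\mathbb E[X]=\mathbb E[Y]$ and $\mathbb E[u(X)]\le\mathbb E[u(Y)]$ (in $(-\infty,\infty]$) for all increasing convex $u:\mathbb R\to\mathbb R$. Then $\succeq$ satisfies all of the axioms - (B1) for all $c_1,c_2\in\mathbb R$: if $c_1\le c_2$, then $c_1\succeq c_2$; - (A2) for all $X,Y\in L^p$ and $c\in\mathbb R$: $X\succeq Y$ if and only if $X+c\succeq Y+c$; - (A3) for all $X,Y\in L^p$: if $\mathbb E[X]=\mathbb E[Y]$ and $X\succeq Y$, then $\lambda X\succeq\lambda Y$ for all $\lambda>0$; - (A4) for all $X,Y\in L^p$: if $X\le_{\rm cx}Y$, then $X\succeq Y$; moreover $\mathbb E[X]\succ X$ for every nonconstant $X\in L^p$; - (A5) for every $X\in L^p$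 there is $c\in\mathbb R$ with $X\simeq c$; - (A6) for all $X,Y\in L^p$: if $\mathbb E[X]=\mathbb E[Y]$ and $X\simeq Y$, then $\lambda X+(1-\lambda)Y\succeq X$ for all $\lambda\in[0,1]$; - (A7) for every $X\in L^p$ the sets $\{Y\in L^p: Y\succeq X\}$ and $\{Y\in L^p: X\succeq Y\}$ are closed in the $L^p$-norm if and only if there are an $L^p$-norm continuous law-invariant deviation measure $D:L^p\to[0,\infty)$ and a continuous, strictly increasing function $g:[0,\infty)\to\mathbb R$ such that, for all $X,Y\in L^p$, $$X\succeq Y\iff g(D(X))+\mathbb E[X]\le g(D(Y))+\mathbb E[Y].$$ Here $D:L^p\to[0,\infty)$ is a law-invariant deviation measure if, for all $X,Y\in L^p$: $D(X+c)=D(X)$ for $c\in\mathbb R$; $D(X)>0$ if $X$ is nonconstant; $D(\lambda X)=\lambda D(X)$ for $\lambda\ge0$; $D(X+Y)\le D(X)+D(Y)$; and $D(X)=D(Y)$ if $X$ and $Y$ have the same distribution. -/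

import Mathlib

open MeasureTheory ProbabilityTheory
open scoped NNReal ENNReal

namespace MeanDeviation

/-- A measure is nonatomic if every measurable set of positive measure has a measurable subset
of positive and strictly smaller measure. (On a general measurable space this is stronger than
saying that points have measure zero.) -/
def IsNonatomic {Ω : Type*} [MeasurableSpace Ω] (P : Measure Ω) : Prop :=
  ∀ A : Set Ω, MeasurableSet A → 0 < P A →
    ∃ B : Set Ω, MeasurableSet B ∧ B ⊆ A ∧ 0 < P B ∧ P B < P A

section

variable {Ω : Type*} [MeasurableSpace Ω] {P : Measure Ω} {p : ℝ≥0∞}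

/-- The expectation `E[X]` of a random variable `X ∈ L^p`. -/
noncomputable def expect (X : Lp ℝ p P) : ℝ := ∫ ω, X ω ∂P

/-- `X` is (almost surely) constant. -/
def IsConstant [IsFiniteMeasure P] (X : Lp ℝ p P) : Prop := ∃ c : ℝ, X = Lp.const p P c

/-- Second-order stochastic dominance `X ≤_SSD Y` for losses: `E[u(X)] ≤ E[u(Y)]` for all
increasing convex `u : ℝ → ℝ`. For integrable `X`, the negative part of `u(X)` is integrable, as
`u` has an affine minorant; so `E[u(X)]` always exists in `(-∞, ∞]`, and it is finite exactly
if `u(X)` is integrable. The inequality below is the one in `(-∞, ∞]`. -/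
def SSDLe (X Y : Lp ℝ p P) : Prop :=
  ∀ u : ℝ → ℝ, Monotone u → ConvexOn ℝ Set.univ u →
    Integrable (fun ω => u (Y ω)) P →
      Integrable (fun ω => u (X ω)) P ∧ ∫ ω, u (X ω) ∂P ≤ ∫ ω, u (Y ω) ∂P

/-- Convex order `X ≤_cx Y`: `X ≤_SSD Y` and `E[X] = E[Y]`. -/
def ConvexLe (X Y : Lp ℝ p P) : Prop := SSDLe X Y ∧ expect X = expect Y

/-- A law-invariant deviation measure on `L^p`. -/
structure IsLawInvariantDeviation [IsFiniteMeasure P] (D : Lp ℝ p P → ℝ≥0) : Prop where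
  add_const : ∀ (X : Lp ℝ p P) (c : ℝ), D (X + Lp.const p P c) = D X
  pos : ∀ X : Lp ℝ p P, ¬ IsConstant X → 0 < D X
  smul : ∀ (X : Lp ℝ p P) (l : ℝ≥0), D ((l : ℝ) • X) = l * D X
  add_le : ∀ X Y : Lp ℝ p P, D (X + Y) ≤ D X + D Y
  law_invariant : ∀ X Y : Lp ℝ p P, IdentDistrib X Y P P → D X = D Y

/-- A preference relation: a total preorder. `R X Y` reads `X ⪰ Y`, that is, the loss `X` is
(weakly) preferred to the loss `Y`. -/
structure IsPreference (R : Lp ℝ p P → Lp ℝ p P → Prop) : Prop where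
  refl : ∀ X, R X X
  trans : ∀ X Y Z, R X Y → R Y Z → R X Z
  total : ∀ X Y, R X Y ∨ R Y X

/-- Strict preference `X ≻ Y`. -/
def StrictPref (R : Lp ℝ p P → Lp ℝ p P → Prop) (X Y : Lp ℝ p P) : Prop := R X Y ∧ ¬ R Y X

/-- Indifference `X ≃ Y`. -/
def Indiff (R : Lp ℝ p P → Lp ℝ p P → Prop) (X Y : Lp ℝ p P) : Prop := R X Y ∧ R Y X

/-- Monotonicity on constants. -/
def MonotoneOnConstants [IsFiniteMeasure P] (R : Lp ℝ p P → Lp ℝ p P → Prop) : Prop :=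
  ∀ c₁ c₂ : ℝ, c₁ ≤ c₂ → R (Lp.const p P c₁) (Lp.const p P c₂)

/-- Translation-invariance. -/
def TranslationInvariant [IsFiniteMeasure P] (R : Lp ℝ p P → Lp ℝ p P → Prop) : Prop :=
  ∀ (c : ℝ) (X Y : Lp ℝ p P), R X Y ↔ R (X + Lp.const p P c) (Y + Lp.const p P c)

/-- Weak positive homogeneity. -/
def WeaklyPosHomogeneous (R : Lp ℝ p P → Lp ℝ p P → Prop) : Prop :=
  ∀ X Y : Lp ℝ p P, expect X = expect Y → R X Y → ∀ l : ℝ, 0 < l → R (l • X) (l • Y)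

/-- Risk aversion. -/
def RiskAverse [IsFiniteMeasure P] (R : Lp ℝ p P → Lp ℝ p P → Prop) : Prop :=
  (∀ X Y : Lp ℝ p P, ConvexLe X Y → R X Y) ∧
    ∀ X : Lp ℝ p P, ¬ IsConstant X → StrictPref R (Lp.const p P (expect X)) X

/-- Solvability. -/
def Solvable [IsFiniteMeasure P] (R : Lp ℝ p P → Lp ℝ p P → Prop) : Prop :=
  ∀ X : Lp ℝ p P, ∃ c : ℝ, Indiff R X (Lp.const p P c)

/-- Weak convexity. -/
def WeaklyConvex (R : Lp ℝ p P → Lp ℝ p P → Prop) : Prop :=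
  ∀ X Y : Lp ℝ p P, expect X = expect Y → Indiff R X Y →
    ∀ l : ℝ, 0 ≤ l → l ≤ 1 → R (l • X + (1 - l) • Y) X

/-- Continuity: upper and lower contour sets are closed in the `L^p` norm. -/
def ContinuousPref [Fact (1 ≤ p)] (R : Lp ℝ p P → Lp ℝ p P → Prop) : Prop :=
  ∀ X : Lp ℝ p P, IsClosed {Y : Lp ℝ p P | R Y X} ∧ IsClosed {Y : Lp ℝ p P | R X Y}

/-- `ρ` represents the preference `R`: `X ⪰ Y ↔ ρ X ≤ ρ Y`. -/
def Represents (ρ : Lp ℝ p P → ℝ) (R : Lp ℝ p P → Lp ℝ p P → Prop) : Prop :=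
  ∀ X Y : Lp ℝ p P, R X Y ↔ ρ X ≤ ρ Y

/-- The functional `g ∘ D + E`. -/
noncomputable def meanDeviation (g : ℝ≥0 → ℝ) (D : Lp ℝ p P → ℝ≥0) (X : Lp ℝ p P) : ℝ :=
  g (D X) + expect X

end

end MeanDeviation

/-!
# Axioms for mean-deviation preferences

**From the axioms to the representation.** Fix a nonconstant `Z` with mean zero. By risk aversion,
homogeneity and continuity, `t ↦ t • Z` is strictly worse for larger `t ≥ 0`, and every `X - E[X]`
is indifferent to exactly one multiple `D X • Z` (`not_pref_smul_of_lt`, `exists_indiff_smul`).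
Homogeneity of the preference makes `D` positively homogeneous, and weak convexity applied to
variables rescaled to deviation one makes it subadditive. Random variables with the same
distribution dominate each other in the convex order, whence `D` is law-invariant. If `g t` is the
certainty equivalent of `t • Z`, translation-invariance gives `g (D X) + E[X]` as the certainty
equivalent of `X` (`exists_meanDeviation_of_axioms`).

**From the representation to the axioms.** Everything is immediate but the monotonicity of `D` in
the convex order, which holds for every convex, continuous, law-invariant functional `Φ` on `L^p`
of a nonatomic space (`IsLawInvariantConvex.le_of_convexLe`). The dual of `L^∞` is avoided by an
argument with rearrangements that is uniform in `p`.

* Averaging a random variable over an event lowers `Φ`. For a variable with two values on the event,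
  `n` copies of the subset where the first value is taken are spread evenly over the event; the mean
  of the corresponding rearrangements is uniformly within `O(1 / n)` of the average
  (`IsLawInvariantConvex.avgOn_union_le`). Simple functions follow by merging level sets, and
  general ones by density.
* Applied to the norm, this shows that conditional expectations given discrete variables are
  contractions, so `X` can be replaced by a conditional expectation `x ∘ κ` with a decreasing
  sequence `x`.
* On a nonatomic space `κ` has a copy `κ'` that is countermonotone with `Y`
  (`exists_countermonotone_copy`). With `y ∘ κ'` the conditional expectation of `Y` given `κ'`, the
  convex order between `X` and `Y` says that the weighted partial sums of `y` dominate those of `x`.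
  By the weighted Hardy-Littlewood-Pólya theorem (`mem_of_transfers`) `x` is obtained from `y` by
  transfers, each of which is a partial averaging and lowers `Φ`.
-/

namespace MeanDeviation

variable {Ω : Type*} [MeasurableSpace Ω] {P : Measure Ω} {p : ℝ≥0∞}

/-! ### Intermediate values of nonatomic measures -/

/-- Repeated halving produces subsets of positive, arbitrarily small measure. -/
theorem IsNonatomic.exists_subset_measure_lt [IsProbabilityMeasure P] (hP : IsNonatomic P)
    {A : Set Ω} (hA : MeasurableSet A) (hA0 : 0 < P A) {ε : ℝ≥0∞} (hε : 0 < ε) :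
    ∃ B, MeasurableSet B ∧ B ⊆ A ∧ 0 < P B ∧ P B < ε := by
  have half : ∀ n : ℕ, ∃ B, MeasurableSet B ∧ B ⊆ A ∧ 0 < P B ∧ P B ≤ 2⁻¹ ^ n := by
    intro n
    induction n with
    | zero => exact ⟨A, hA, subset_rfl, hA0, by simpa using prob_le_one⟩
    | succ n ih =>
      obtain ⟨B, hB, hBA, hB0, hBn⟩ := ih
      obtain ⟨C, hC, hCB, hC0, hClt⟩ := hP B hB hB0
      have hsum : P C + P (B \ C) = P B := by
        rw [← measure_inter_add_sdiff B hC, Set.inter_eq_right.2 hCB]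
      have hpos : 0 < P (B \ C) := by
        rw [pos_iff_ne_zero]
        intro h
        rw [h, add_zero] at hsum
        exact hClt.ne hsum
      have key : ∀ x y : ℝ≥0∞, x ≤ y → x + y ≤ 2⁻¹ ^ n → x ≤ 2⁻¹ ^ (n + 1) := by
        intro x y hxy h
        have h2 : x + x ≤ 2⁻¹ ^ n := (by gcongr : x + x ≤ x + y).trans h
        rw [← two_mul] at h2
        calc x = 2⁻¹ * (2 * x) := by
              rw [← mul_assoc, ENNReal.inv_mul_cancel two_ne_zero ENNReal.ofNat_ne_top, one_mul]
          _ ≤ 2⁻¹ * 2⁻¹ ^ n := by gcongr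
          _ = 2⁻¹ ^ (n + 1) := by rw [pow_succ, mul_comm]
      rcases le_total (P C) (P (B \ C)) with h | h
      · exact ⟨C, hC, hCB.trans hBA, hC0, key _ _ h (hsum.trans_le hBn)⟩
      · exact ⟨B \ C, hB.diff hC, Set.sdiff_subset.trans hBA, hpos,
          key _ _ h (by rw [add_comm]; exact hsum.trans_le hBn)⟩
  obtain ⟨n, hn⟩ := ENNReal.exists_inv_two_pow_lt hε.ne'
  obtain ⟨B, hB, hBA, hB0, hBn⟩ := half n
  exact ⟨B, hB, hBA, hB0, hBn.trans_lt hn⟩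

/-- Sierpiński's theorem. The subset is exhausted greedily: at each step a set is added whose
measure is at least half of what is possible. -/
theorem IsNonatomic.exists_subset_measure_eq [IsProbabilityMeasure P] (hP : IsNonatomic P)
    {A : Set Ω} (hA : MeasurableSet A) {c : ℝ≥0∞} (hc : c ≤ P A) :
    ∃ B, MeasurableSet B ∧ B ⊆ A ∧ P B = c := by
  let S := {B : Set Ω // MeasurableSet B ∧ B ⊆ A ∧ P B ≤ c}
  have hctop : c ≠ ∞ := (hc.trans_lt (measure_lt_top P A)).ne
  have step : ∀ B : S, ∃ B' : S, B.1 ⊆ B'.1 ∧ ∀ E, MeasurableSet E → E ⊆ A \ B.1 →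
      P B.1 + P E ≤ c → P B.1 + P E / 2 ≤ P B'.1 := by
    rintro ⟨B, hB, hBA, hBc⟩
    let V : Set ℝ≥0∞ := {x | ∃ E, MeasurableSet E ∧ E ⊆ A \ B ∧ P B + P E ≤ c ∧ P E = x}
    have hV : ∀ E, MeasurableSet E → E ⊆ A \ B → P B + P E ≤ c → P E ≤ sSup V :=
      fun E h1 h2 h3 => le_sSup ⟨E, h1, h2, h3, rfl⟩
    rcases eq_or_ne (sSup V) 0 with h0 | h0
    · refine ⟨⟨B, hB, hBA, hBc⟩, subset_rfl, fun E h1 h2 h3 => ?_⟩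
      have := hV E h1 h2 h3
      rw [h0, nonpos_iff_eq_zero] at this
      simp [this]
    · have hfin : sSup V ≠ ∞ := by
        refine (lt_of_le_of_lt (sSup_le ?_) (measure_lt_top P A)).ne
        rintro x ⟨E, -, h2, -, rfl⟩
        exact measure_mono (h2.trans Set.sdiff_subset)
      obtain ⟨x, ⟨E, h1, h2, h3, rfl⟩, hx⟩ := lt_sSup_iff.1 (ENNReal.half_lt_self h0 hfin)
      have hd : P (B ∪ E) = P B + P E :=
        measure_union (Set.disjoint_left.2 fun ω hω hE => (h2 hE).2 hω) h1
      refine ⟨⟨B ∪ E, hB.union h1, Set.union_subset hBA (h2.trans Set.sdiff_subset),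
        hd.trans_le h3⟩, Set.subset_union_left, fun E' h1' h2' h3' => ?_⟩
      change _ ≤ P (B ∪ E)
      rw [hd]
      gcongr
      exact (ENNReal.div_le_div_right (hV E' h1' h2' h3') 2).trans hx.le
  choose next hsub hnext using step
  let s : ℕ → S := fun n => next^[n] ⟨∅, MeasurableSet.empty, Set.empty_subset _, by simp⟩
  have hs : ∀ n, s (n + 1) = next (s n) := fun n => Function.iterate_succ_apply' _ _ _
  have hmono : Monotone fun n => (s n).1 :=
    monotone_nat_of_le_succ fun n => by rw [hs]; exact hsub _
  have hU : MeasurableSet (⋃ n, (s n).1) := MeasurableSet.iUnion fun n => (s n).2.1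
  have hUc : P (⋃ n, (s n).1) ≤ c := by
    rw [hmono.measure_iUnion]
    exact iSup_le fun n => (s n).2.2.2
  refine ⟨_, hU, Set.iUnion_subset fun n => (s n).2.2.1, ?_⟩
  by_contra hne
  have hlt : P (⋃ n, (s n).1) < c := lt_of_le_of_ne hUc hne
  have hpos : 0 < P (A \ ⋃ n, (s n).1) :=
    (tsub_pos_of_lt (hlt.trans_le hc)).trans_le le_measure_sdiff
  obtain ⟨E, hE, hEA, hE0, hElt⟩ := hP.exists_subset_measure_lt (hA.diff hU) hpos
    (tsub_pos_of_lt hlt)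
  have grow : ∀ n : ℕ, n * (P E / 2) ≤ P (s n).1 := by
    intro n
    induction n with
    | zero => simp
    | succ n ih =>
      have hn : (s n).1 ⊆ ⋃ n, (s n).1 := Set.subset_iUnion (fun n => (s n).1) n
      rw [hs]
      refine le_trans ?_ (hnext (s n) E hE (hEA.trans (Set.sdiff_subset_sdiff_right hn)) ?_)
      · push_cast
        rw [add_mul, one_mul]
        gcongr
      · calc P (s n).1 + P E ≤ P (⋃ n, (s n).1) + (c - P (⋃ n, (s n).1)) := by gcongr
          _ = c := add_tsub_cancel_of_le hUc
  obtain ⟨n, hn⟩ := ENNReal.exists_nat_mul_gt (ENNReal.half_pos hE0.ne').ne' hctop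
  exact absurd ((grow n).trans (s n).2.2.2) (not_le.2 hn)

theorem IsNonatomic.exists_between_measure_eq [IsProbabilityMeasure P] (hP : IsNonatomic P)
    {A B : Set Ω} (hA : MeasurableSet A) (hB : MeasurableSet B) (hAB : A ⊆ B) {c : ℝ≥0∞}
    (hAc : P A ≤ c) (hcB : c ≤ P B) :
    ∃ C, MeasurableSet C ∧ A ⊆ C ∧ C ⊆ B ∧ P C = c := by
  obtain ⟨E, hE, hEB, hPE⟩ := hP.exists_subset_measure_eq (hB.diff hA)
    ((tsub_le_tsub_right hcB (P A)).trans le_measure_sdiff)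
  refine ⟨A ∪ E, hA.union hE, Set.subset_union_left,
    Set.union_subset hAB (hEB.trans Set.sdiff_subset), ?_⟩
  rw [measure_union (Set.disjoint_left.2 fun ω hω h => (hEB h).2 hω) hE, hPE,
    add_tsub_cancel_of_le hAc]

/-- Copies `T 0, …, T (n - 1)` of the size `c` can be spread over `A` as evenly as possible: the
numbers of copies that cover two points of `A` differ by at most one. -/
theorem IsNonatomic.exists_even_cover [IsProbabilityMeasure P] (hP : IsNonatomic P)
    {A : Set Ω} (hA : MeasurableSet A) {c : ℝ≥0∞} (hc : c ≤ P A) (n : ℕ) :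
    ∃ (T : ℕ → Set Ω) (m : ℕ), (∀ k, MeasurableSet (T k) ∧ T k ⊆ A ∧ P (T k) = c) ∧
      ∀ ω ∈ A, ∑ k ∈ Finset.range n, (T k).indicator (fun _ => (1 : ℝ)) ω = m ∨
        ∑ k ∈ Finset.range n, (T k).indicator (fun _ => (1 : ℝ)) ω = m + 1 := by
  induction n with
  | zero =>
    obtain ⟨T, hT, hTA, hTc⟩ := hP.exists_subset_measure_eq hA hc
    exact ⟨fun _ => T, 0, fun _ => ⟨hT, hTA, hTc⟩, by simp⟩
  | succ n ih =>
    obtain ⟨T, m, hT, hm⟩ := ih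
    set N : Ω → ℝ := fun ω => ∑ k ∈ Finset.range n, (T k).indicator (fun _ => (1 : ℝ)) ω with hN
    have hNm : Measurable N := by
      refine Finset.measurable_sum _ fun k _ => ?_
      exact measurable_const.indicator (hT k).1
    -- the part of `A` that is covered least so far is to be used first
    set L : Set Ω := A ∩ {ω | N ω = m} with hL
    have hLm : MeasurableSet L := hA.inter (hNm (measurableSet_singleton _))
    have upd : ∀ T' : Set Ω, ∀ ω,
        ∑ k ∈ Finset.range (n + 1), (Function.update T n T' k).indicator (fun _ => (1 : ℝ)) ω
          = N ω + T'.indicator (fun _ => (1 : ℝ)) ω := by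
      intro T' ω
      rw [Finset.sum_range_succ, Function.update_self]
      congr 1
      refine Finset.sum_congr rfl fun k hk => ?_
      rw [Function.update_of_ne (Finset.mem_range.1 hk).ne]
    have updP : ∀ T' : Set Ω, MeasurableSet T' → T' ⊆ A → P T' = c → ∀ k,
        MeasurableSet (Function.update T n T' k) ∧ Function.update T n T' k ⊆ A ∧
          P (Function.update T n T' k) = c := by
      intro T' h1 h2 h3 k
      rcases eq_or_ne k n with rfl | hk
      · rw [Function.update_self]; exact ⟨h1, h2, h3⟩
      · rw [Function.update_of_ne hk]; exact hT k
    rcases le_total c (P L) with hcL | hcL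
    · obtain ⟨T', hT', hT'L, hT'c⟩ := hP.exists_subset_measure_eq hLm hcL
      refine ⟨Function.update T n T', m, updP T' hT' (hT'L.trans Set.inter_subset_left) hT'c,
        fun ω hω => ?_⟩
      rw [upd]
      by_cases h : ω ∈ T'
      · right
        rw [Set.indicator_of_mem h, (hT'L h).2]
      · rw [Set.indicator_of_notMem h, add_zero]
        exact hm ω hω
    · obtain ⟨T', hT', hLT', hT'A, hT'c⟩ :=
        hP.exists_between_measure_eq hLm hA Set.inter_subset_left hcL hc
      refine ⟨Function.update T n T', m + 1, updP T' hT' hT'A hT'c, fun ω hω => ?_⟩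
      rw [upd]
      push_cast
      by_cases h : ω ∈ T'
      · rw [Set.indicator_of_mem h]
        rcases hm ω hω with h' | h'
        · left; rw [hN]; simp only [h']
        · right; rw [hN]; simp only [h']
      · left
        rw [Set.indicator_of_notMem h, add_zero]
        rcases hm ω hω with h' | h'
        · exact absurd (hLT' ⟨hω, h'⟩) h
        · exact h'

/-! ### Averaging lowers law-invariant convex functionals -/

/-- A functional on random variables which, on those with finite `L^p` norm, is convex,
depends only on the distribution, and is continuous for the `L^p` norm. Its values at functions
outside `L^p` are irrelevant. -/
structure IsLawInvariantConvex (P : Measure Ω) (p : ℝ≥0∞) (Φ : (Ω → ℝ) → ℝ) : Prop where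
  convexOn : ConvexOn ℝ {f | MemLp f p P} Φ
  law_invariant : ∀ f g, MemLp f p P → IdentDistrib f g P P → Φ f = Φ g
  continuous : ∀ f, MemLp f p P → ∀ ε > 0, ∃ δ > 0, ∀ g, MemLp g p P →
    eLpNorm (g - f) p P ≤ ENNReal.ofReal δ → |Φ g - Φ f| ≤ ε

/-- The function that agrees with `f` off `A` and on `A` takes as constant value the mean of `f`
over `A` (the value is zero if `A` is a null set). -/
noncomputable def avgOn (P : Measure Ω) (A : Set Ω) (f : Ω → ℝ) : Ω → ℝ :=
  A.indicator (fun _ => ⨍ x in A, f x ∂P) + Aᶜ.indicator f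

theorem avgOn_of_mem {A : Set Ω} {f : Ω → ℝ} {ω : Ω} (h : ω ∈ A) :
    avgOn P A f ω = ⨍ x in A, f x ∂P := by
  simp [avgOn, h]

theorem avgOn_of_notMem {A : Set Ω} {f : Ω → ℝ} {ω : Ω} (h : ω ∉ A) : avgOn P A f ω = f ω := by
  simp [avgOn, h]

theorem memLp_avgOn [IsFiniteMeasure P] {A : Set Ω} (hA : MeasurableSet A) {f : Ω → ℝ}
    (hf : MemLp f p P) : MemLp (avgOn P A f) p P := by
  have h1 : MemLp (A.indicator fun _ : Ω => ⨍ x in A, f x ∂P) p P := (memLp_const _).indicator hA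
  exact h1.add (hf.indicator hA.compl)

theorem setIntegral_avgOn [IsFiniteMeasure P] {A : Set Ω} (hA : MeasurableSet A) {f : Ω → ℝ} :
    ∫ x in A, avgOn P A f x ∂P = ∫ x in A, f x ∂P := by
  rw [setIntegral_congr_fun hA fun ω hω => avgOn_of_mem hω, setIntegral_const,
    measure_smul_setAverage _ (measure_ne_top P A)]

/-- Moving the set on which a two-valued function takes one of its values does not change the
distribution, if the measure of that set is kept. -/
theorem identDistrib_of_two_valued [IsFiniteMeasure P] {f g : Ω → ℝ} (hf : AEMeasurable f P)
    (hg : AEMeasurable g P) {A T T' : Set Ω} (hA : MeasurableSet A) (hT : MeasurableSet T)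
    (hT' : MeasurableSet T') (hTA : T ⊆ A) (hTA' : T' ⊆ A) (hTT' : P T = P T') {a b : ℝ}
    (hfT : ∀ ω ∈ T, f ω = a) (hfA : ∀ ω ∈ A \ T, f ω = b) (hgT : ∀ ω ∈ T', g ω = a)
    (hgA : ∀ ω ∈ A \ T', g ω = b) (hfg : ∀ ω ∉ A, f ω = g ω) : IdentDistrib f g P P := by
  refine ⟨hf, hg, Measure.ext fun s hs => ?_⟩
  rw [Measure.map_apply_of_aemeasurable hf hs, Measure.map_apply_of_aemeasurable hg hs]
  have split : ∀ (h : Ω → ℝ) (S : Set Ω), MeasurableSet S → S ⊆ A → (∀ ω ∈ S, h ω = a) →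
      (∀ ω ∈ A \ S, h ω = b) → P (h ⁻¹' s) = P (h ⁻¹' s \ A) +
        (s.indicator (fun _ => P S) a + s.indicator (fun _ => P A - P S) b) := by
    intro h S hS hSA h1 h2
    rw [← measure_inter_add_sdiff (h ⁻¹' s) hA, add_comm,
      ← measure_inter_add_sdiff (h ⁻¹' s ∩ A) hS]
    congr 2
    · by_cases ha : a ∈ s
      · rw [Set.indicator_of_mem ha]
        congr 1
        ext ω
        exact ⟨fun h => h.2, fun h => ⟨⟨by simpa [h1 ω h] using ha, hSA h⟩, h⟩⟩
      · rw [Set.indicator_of_notMem ha]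
        convert measure_empty (μ := P)
        refine Set.eq_empty_of_forall_notMem fun ω hω => ha ?_
        rw [← h1 ω hω.2]
        exact hω.1.1
    · by_cases hb : b ∈ s
      · rw [Set.indicator_of_mem hb, ← measure_sdiff hSA hS.nullMeasurableSet (measure_ne_top P S)]
        congr 1
        ext ω
        exact ⟨fun h => ⟨h.1.2, h.2⟩, fun h => ⟨⟨by simpa [h2 ω h] using hb, h.1⟩, h.2⟩⟩
      · rw [Set.indicator_of_notMem hb]
        convert measure_empty (μ := P)
        refine Set.eq_empty_of_forall_notMem fun ω hω => hb ?_
        rw [← h2 ω ⟨hω.1.2, hω.2⟩]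
        exact hω.1.1
  rw [split f T hT hTA hfT hfA, split g T' hT' hTA' hgT hgA, hTT']
  congr 2
  ext ω
  refine and_congr_left fun h => ?_
  change f ω ∈ s ↔ g ω ∈ s
  rw [hfg ω h]

theorem IsLawInvariantConvex.congr_ae {Φ : (Ω → ℝ) → ℝ} (hΦ : IsLawInvariantConvex P p Φ)
    {f g : Ω → ℝ} (hf : MemLp f p P) (h : f =ᵐ[P] g) : Φ f = Φ g :=
  hΦ.law_invariant f g hf (.of_ae_eq hf.aestronglyMeasurable.aemeasurable h)

theorem avgOn_ae_eq_of_measure_eq_zero {A : Set Ω} (h : P A = 0) (f : Ω → ℝ) :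
    avgOn P A f =ᵐ[P] f := by
  filter_upwards [measure_eq_zero_iff_ae_notMem.1 h] with ω hω using avgOn_of_notMem hω

/-- If `f` takes one value on `T` and another one on `U`, then averaging it over `U ∪ T` lowers
a law-invariant convex functional. The value of `f` on `T` is moved to `n` copies of `T` that are
spread evenly over `U ∪ T`. Each of these functions has the distribution of `f`, and their mean
differs from the average of `f` by a multiple of `1 / n`, uniformly. -/
theorem IsLawInvariantConvex.avgOn_union_le [IsProbabilityMeasure P] (hP : IsNonatomic P)
    {Φ : (Ω → ℝ) → ℝ} (hΦ : IsLawInvariantConvex P p Φ) {f : Ω → ℝ} (hf : MemLp f p P)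
    {U T : Set Ω} (hU : MeasurableSet U) (hT : MeasurableSet T) (hUT : Disjoint U T) {a b : ℝ}
    (hfU : ∀ ω ∈ U, f ω = b) (hfT : ∀ ω ∈ T, f ω = a) : Φ (avgOn P (U ∪ T) f) ≤ Φ f := by
  set A := U ∪ T with hAdef
  have hA : MeasurableSet A := hU.union hT
  have hTA : T ⊆ A := Set.subset_union_right
  rcases eq_or_ne (P A) 0 with hA0 | hA0
  · exact (hΦ.congr_ae hf (avgOn_ae_eq_of_measure_eq_zero hA0 f).symm).ge
  have hAr : 0 < P.real A := ENNReal.toReal_pos hA0 (measure_ne_top P A)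
  have havg : ⨍ x in A, f x ∂P = b + (a - b) * (P.real T / P.real A) := by
    have h1 : ∫ x in A, f x ∂P = P.real U * b + P.real T * a := by
      rw [setIntegral_union hUT hT, setIntegral_congr_fun hU hfU, setIntegral_congr_fun hT hfT,
        setIntegral_const, setIntegral_const, smul_eq_mul, smul_eq_mul]
      · exact (integrableOn_const (measure_ne_top P U)).congr_fun (fun ω hω => (hfU ω hω).symm) hU
      · exact (integrableOn_const (measure_ne_top P T)).congr_fun (fun ω hω => (hfT ω hω).symm) hT
    have h2 : P.real A = P.real U + P.real T := measureReal_union hUT hT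
    rw [setAverage_eq, h1, smul_eq_mul]
    field_simp
    rw [h2]
    ring
  refine le_of_forall_pos_le_add fun ε hε => ?_
  obtain ⟨δ, hδ, hcont⟩ := hΦ.continuous _ (memLp_avgOn hA hf) ε hε
  obtain ⟨n, hn⟩ := exists_nat_gt (|a - b| / δ)
  have hn0 : (0 : ℝ) < n := lt_of_le_of_lt (by positivity) hn
  obtain ⟨S, m, hS, hm⟩ := hP.exists_even_cover hA (measure_mono hTA) n
  let g : ℕ → Ω → ℝ := fun k => Aᶜ.indicator f + A.indicator (fun _ => b) +
    (S k).indicator (fun _ => a - b)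
  have hg : ∀ k, MemLp (g k) p P := fun k =>
    ((hf.indicator hA.compl).add ((memLp_const _).indicator hA)).add
      ((memLp_const _).indicator (hS k).1)
  have hΦg : ∀ k, Φ (g k) = Φ f := by
    intro k
    symm
    refine hΦ.law_invariant f (g k) hf (identDistrib_of_two_valued (a := a) (b := b)
      hf.aestronglyMeasurable.aemeasurable (hg k).aestronglyMeasurable.aemeasurable hA hT (hS k).1
      hTA (hS k).2.1 (hS k).2.2.symm hfT ?_ ?_ ?_ ?_)
    · rintro ω ⟨h | h, h'⟩
      · exact hfU ω h
      · exact absurd h h'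
    · intro ω hω
      simp [g, (hS k).2.1 hω, hω]
    · rintro ω ⟨h, h'⟩
      simp [g, h, h']
    · intro ω hω
      have : ω ∉ S k := fun h => hω ((hS k).2.1 h)
      simp [g, hω, this]
  set h : Ω → ℝ := ∑ k ∈ Finset.range n, (1 / n : ℝ) • g k with hh
  have hhΦ : Φ h ≤ Φ f := by
    refine (hΦ.convexOn.map_sum_le (fun _ _ => by positivity) ?_ fun k _ => hg k).trans ?_
    · simp [hn0.ne']
    · simp only [hΦg]
      rw [← Finset.sum_smul]
      simp [hn0.ne']
  have hhp : MemLp h p P := memLp_finsetSum' _ fun k _ => (hg k).const_smul _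
  set N : Ω → ℝ := fun ω => ∑ k ∈ Finset.range n, (S k).indicator (fun _ => (1 : ℝ)) ω with hN
  have hval : ∀ ω, h ω = Aᶜ.indicator f ω + A.indicator (fun _ => b) ω + (a - b) * (N ω / n) := by
    intro ω
    have : ∀ k, (S k).indicator (fun _ => a - b) ω
        = (a - b) * (S k).indicator (fun _ => (1 : ℝ)) ω := by
      intro k
      by_cases hk : ω ∈ S k <;> simp [hk]
    simp only [hh, Finset.sum_apply, Pi.smul_apply, smul_eq_mul, ← Finset.mul_sum, g, Pi.add_apply,
      Finset.sum_add_distrib, Finset.sum_const, Finset.card_range, nsmul_eq_mul, this, hN]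
    field_simp
  have hNint : ∫ ω in A, N ω ∂P = n * P.real T := by
    rw [hN, integral_finsetSum _ fun k _ => (integrable_const _).indicator (hS k).1]
    have : ∀ k, ∫ ω in A, (S k).indicator (fun _ => (1 : ℝ)) ω ∂P = P.real T := by
      intro k
      rw [integral_indicator (hS k).1, Measure.restrict_restrict (hS k).1,
        Set.inter_eq_left.2 (hS k).2.1, setIntegral_const, smul_eq_mul, mul_one, measureReal_def,
        (hS k).2.2, measureReal_def]
    simp [this]
  have hNi : IntegrableOn N A P :=
    integrable_finsetSum _ fun k _ => (integrable_const _).indicator (hS k).1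
  have hlow : m * P.real A ≤ n * P.real T := by
    rw [← hNint, mul_comm, ← smul_eq_mul, ← setIntegral_const]
    refine setIntegral_mono_on (integrableOn_const (measure_ne_top P A)) hNi hA fun ω hω => ?_
    rcases hm ω hω with h | h <;> simp only [hN, h] <;> linarith
  have hup : n * P.real T ≤ (m + 1) * P.real A := by
    rw [← hNint, mul_comm _ (P.real A), ← smul_eq_mul, ← setIntegral_const]
    refine setIntegral_mono_on hNi (integrableOn_const (measure_ne_top P A)) hA fun ω hω => ?_
    rcases hm ω hω with h | h <;> simp only [hN, h] <;> linarith
  have hclose : ∀ ω, ‖(h - avgOn P A f) ω‖ ≤ δ := by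
    intro ω
    rw [Pi.sub_apply, hval]
    by_cases hω : ω ∈ A
    · rw [avgOn_of_mem hω, havg]
      have e : Aᶜ.indicator f ω + A.indicator (fun _ => b) ω + (a - b) * (N ω / n) -
          (b + (a - b) * (P.real T / P.real A)) = (a - b) * (N ω / n - P.real T / P.real A) := by
        simp [hω]; ring
      have h3 : |N ω / n - P.real T / P.real A| ≤ 1 / n := by
        have h4 : N ω / n - P.real T / P.real A
            = (N ω * P.real A - n * P.real T) / P.real A * (1 / n) := by
          field_simp
        rw [h4, abs_mul, abs_of_pos (one_div_pos.2 hn0)]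
        refine mul_le_of_le_one_left (by positivity) ?_
        rw [abs_div, abs_of_pos hAr, div_le_one hAr, abs_le]
        rcases hm ω hω with h | h <;> simp only [hN, h] <;> constructor <;> nlinarith
      rw [e, Real.norm_eq_abs, abs_mul]
      calc |a - b| * |N ω / n - P.real T / P.real A| ≤ |a - b| * (1 / n) := by gcongr
        _ ≤ δ := by
          rw [mul_one_div, div_le_iff₀ hn0]
          rw [div_lt_iff₀ hδ] at hn
          linarith
    · rw [avgOn_of_notMem hω]
      have : N ω = 0 := Finset.sum_eq_zero fun k _ =>
        Set.indicator_of_notMem (fun h => hω ((hS k).2.1 h)) _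
      simp [hω, this, hδ.le]
  have hnorm : eLpNorm (h - avgOn P A f) p P ≤ ENNReal.ofReal δ := by
    refine (eLpNorm_le_of_ae_bound (Filter.Eventually.of_forall hclose)).trans ?_
    simp
  have := abs_le.1 (hcont h hhp hnorm)
  linarith [this.1]

/-- Simple functions are dense in `L^p`, for `p = ∞` too. -/
theorem exists_simpleFunc_eLpNorm_sub_le [IsProbabilityMeasure P] {f : Ω → ℝ} (hf : MemLp f p P)
    {ε : ℝ} (hε : 0 < ε) : ∃ s : SimpleFunc Ω ℝ, eLpNorm (⇑s - f) p P ≤ ENNReal.ofReal ε := by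
  rcases eq_or_ne p ∞ with rfl | hp
  · obtain ⟨g, hg, hfg⟩ := hf.aestronglyMeasurable.aemeasurable
    set C := (eLpNorm f ∞ P).toReal with hC
    have hC0 : 0 ≤ C := ENNReal.toReal_nonneg
    have hbd : ∀ᵐ ω ∂P, |f ω| ≤ C := by
      filter_upwards [ae_le_eLpNormEssSup (f := f) (μ := P)] with ω hω
      rw [hC, eLpNorm_exponent_top, ← Real.norm_eq_abs, ← toReal_enorm]
      refine ENNReal.toReal_mono ?_ hω
      rw [← eLpNorm_exponent_top]
      exact hf.eLpNorm_ne_top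
    let k : Ω → ℤ := fun ω => ⌊max (-C) (min C (g ω)) / ε⌋
    have hk : Measurable k :=
      ((measurable_const.max (measurable_const.min hg)).div_const ε).floor
    have hkr : (Set.range k).Finite := by
      refine (Set.finite_Icc ⌊-C / ε⌋ ⌊C / ε⌋).subset ?_
      rintro _ ⟨ω, rfl⟩
      constructor
      · refine Int.floor_le_floor ?_
        gcongr
        exact le_max_left _ _
      · refine Int.floor_le_floor ?_
        gcongr
        exact max_le (by linarith) (min_le_left _ _)
    let κ : SimpleFunc Ω ℤ := ⟨k, fun z => hk (measurableSet_singleton z), hkr⟩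
    refine ⟨κ.map fun z : ℤ => ε * z, ?_⟩
    refine (eLpNorm_le_of_ae_bound (C := ε) ?_).trans (by simp)
    filter_upwards [hbd, hfg] with ω h1 h2
    have h3 : max (-C) (min C (g ω)) = f ω := by
      rw [abs_le] at h1
      rw [← h2, min_eq_right h1.2, max_eq_right h1.1]
    have h4 : (κ.map fun z : ℤ => ε * z) ω = ε * ⌊f ω / ε⌋ := by
      change ε * (⌊max (-C) (min C (g ω)) / ε⌋ : ℝ) = _
      rw [h3]
    rw [Pi.sub_apply, h4, Real.norm_eq_abs, abs_le]
    have h5 := Int.floor_le (f ω / ε)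
    have h6 := Int.lt_floor_add_one (f ω / ε)
    rw [le_div_iff₀ hε] at h5
    rw [div_lt_iff₀ hε] at h6
    constructor <;> nlinarith
  · obtain ⟨s, hs, -⟩ := hf.exists_simpleFunc_eLpNorm_sub_lt hp (ENNReal.ofReal_pos.2 hε).ne'
    exact ⟨s, by rw [eLpNorm_sub_comm]; exact hs.le⟩

theorem setIntegral_avgOn_of_subset [IsFiniteMeasure P] {U V : Set Ω} (hU : MeasurableSet U)
    (hV : MeasurableSet V) (hUV : U ⊆ V) {f : Ω → ℝ} (hf : Integrable f P) :
    ∫ x in V, avgOn P U f x ∂P = ∫ x in V, f x ∂P := by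
  have hi : Integrable (avgOn P U f) P :=
    memLp_one_iff_integrable.1 (memLp_avgOn hU (memLp_one_iff_integrable.2 hf))
  rw [← integral_inter_add_sdiff hU hf.integrableOn,
    ← integral_inter_add_sdiff hU hi.integrableOn,
    Set.inter_eq_right.2 hUV, setIntegral_avgOn hU,
    setIntegral_congr_fun (hV.diff hU) fun ω hω => avgOn_of_notMem hω.2]

theorem avgOn_avgOn_of_subset [IsFiniteMeasure P] {U V : Set Ω} (hU : MeasurableSet U)
    (hV : MeasurableSet V) (hUV : U ⊆ V) {f : Ω → ℝ} (hf : Integrable f P) :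
    avgOn P V (avgOn P U f) = avgOn P V f := by
  ext ω
  by_cases h : ω ∈ V
  · rw [avgOn_of_mem h, avgOn_of_mem h, setAverage_eq, setAverage_eq,
      setIntegral_avgOn_of_subset hU hV hUV hf]
  · rw [avgOn_of_notMem h, avgOn_of_notMem h, avgOn_of_notMem fun h' => h (hUV h')]

theorem IsLawInvariantConvex.avgOn_simpleFunc_le [IsProbabilityMeasure P] (hP : IsNonatomic P)
    {Φ : (Ω → ℝ) → ℝ} (hΦ : IsLawInvariantConvex P p Φ) (s : SimpleFunc Ω ℝ) {A : Set Ω}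
    (hA : MeasurableSet A) : Φ (avgOn P A s) ≤ Φ s := by
  have hs : ∀ q, MemLp s q P := fun q => s.memLp_of_isFiniteMeasure q P
  -- the level sets of `s` inside `A` are merged one after the other
  have key : ∀ I : Finset ℝ, Φ (avgOn P (A ∩ s ⁻¹' I) s) ≤ Φ s := by
    intro I
    induction I using Finset.induction_on with
    | empty => exact (hΦ.congr_ae (hs p) (avgOn_ae_eq_of_measure_eq_zero (by simp) _).symm).ge
    | insert v I hv ih =>
      have hU : MeasurableSet (A ∩ s ⁻¹' I) := hA.inter (s.measurableSet_preimage _)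
      have hT : MeasurableSet (A ∩ s ⁻¹' {v}) := hA.inter (s.measurableSet_preimage _)
      have hd : Disjoint (A ∩ s ⁻¹' I) (A ∩ s ⁻¹' {v}) := by
        refine Set.disjoint_left.2 fun ω h1 h2 => hv ?_
        have h3 : s ω = v := h2.2
        rw [← h3]
        exact h1.2
      have hun : A ∩ s ⁻¹' (insert v I : Finset ℝ) = (A ∩ s ⁻¹' I) ∪ (A ∩ s ⁻¹' {v}) := by
        rw [← Set.inter_union_distrib_left, ← Set.preimage_union, Finset.coe_insert,
          Set.union_comm, Set.insert_eq]
      rw [hun, ← avgOn_avgOn_of_subset hU (hU.union hT) Set.subset_union_left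
        (memLp_one_iff_integrable.1 (hs 1))]
      refine (hΦ.avgOn_union_le hP (a := v) (memLp_avgOn hU (hs p)) hU hT hd
        (fun ω hω => avgOn_of_mem hω) fun ω hω => ?_).trans ih
      rw [avgOn_of_notMem fun h => Set.disjoint_left.1 hd h hω]
      exact hω.2
  have h := key s.range
  rwa [SimpleFunc.coe_range, Set.preimage_range, Set.inter_univ] at h

theorem eLpNorm_avgOn_le [IsProbabilityMeasure P] [Fact (1 ≤ p)] {A : Set Ω}
    (hA : MeasurableSet A) {h : Ω → ℝ} (hh : MemLp h p P) :
    eLpNorm (avgOn P A h) p P ≤ ENNReal.ofReal (1 + (P.real A)⁻¹) * eLpNorm h p P := by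
  have hi : Integrable h P := hh.integrable Fact.out
  have havg : ‖⨍ x in A, h x ∂P‖ ≤ (P.real A)⁻¹ * (eLpNorm h p P).toReal := by
    rw [setAverage_eq, norm_smul, norm_inv, Real.norm_of_nonneg measureReal_nonneg]
    gcongr
    calc ‖∫ x in A, h x ∂P‖ ≤ ∫ x in A, ‖h x‖ ∂P := norm_integral_le_integral_norm _
      _ ≤ ∫ x, ‖h x‖ ∂P :=
        setIntegral_le_integral hi.norm (Filter.Eventually.of_forall fun _ => norm_nonneg _)
      _ = (eLpNorm h 1 P).toReal := by
        rw [integral_norm_eq_lintegral_enorm hi.aestronglyMeasurable,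
          eLpNorm_one_eq_lintegral_enorm]
      _ ≤ (eLpNorm h p P).toReal := ENNReal.toReal_mono hh.eLpNorm_ne_top
        (eLpNorm_le_eLpNorm_of_exponent_le Fact.out hi.aestronglyMeasurable)
  have h1 : eLpNorm (A.indicator fun _ : Ω => ⨍ x in A, h x ∂P) p P
      ≤ ENNReal.ofReal (P.real A)⁻¹ * eLpNorm h p P := by
    refine (eLpNorm_indicator_le _).trans ?_
    refine (eLpNorm_le_of_ae_bound (Filter.Eventually.of_forall fun _ => havg)).trans ?_
    rw [ENNReal.ofReal_mul (by positivity), ENNReal.ofReal_toReal hh.eLpNorm_ne_top]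
    simp
  have h0 : AEStronglyMeasurable (A.indicator fun _ : Ω => ⨍ x in A, h x ∂P) P :=
    (aestronglyMeasurable_const).indicator hA
  calc eLpNorm (avgOn P A h) p P
      ≤ eLpNorm (A.indicator fun _ : Ω => ⨍ x in A, h x ∂P) p P + eLpNorm (Aᶜ.indicator h) p P :=
        eLpNorm_add_le h0 (hh.aestronglyMeasurable.indicator hA.compl) Fact.out
    _ ≤ ENNReal.ofReal (P.real A)⁻¹ * eLpNorm h p P + eLpNorm h p P :=
        add_le_add h1 (eLpNorm_indicator_le _)
    _ = ENNReal.ofReal (1 + (P.real A)⁻¹) * eLpNorm h p P := by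
        rw [ENNReal.ofReal_add zero_le_one (by positivity), ENNReal.ofReal_one, add_mul, one_mul,
          add_comm]

theorem avgOn_sub {A : Set Ω} {f g : Ω → ℝ} (hf : Integrable f P) (hg : Integrable g P) :
    avgOn P A (g - f) = avgOn P A g - avgOn P A f := by
  ext ω
  by_cases h : ω ∈ A
  · simp only [Pi.sub_apply, avgOn_of_mem h, setAverage_eq,
      integral_sub hg.integrableOn hf.integrableOn, smul_sub]
  · simp only [Pi.sub_apply, avgOn_of_notMem h]

theorem IsLawInvariantConvex.avgOn_le [IsProbabilityMeasure P] (hP : IsNonatomic P)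
    [Fact (1 ≤ p)] {Φ : (Ω → ℝ) → ℝ} (hΦ : IsLawInvariantConvex P p Φ) {f : Ω → ℝ}
    (hf : MemLp f p P) {A : Set Ω} (hA : MeasurableSet A) : Φ (avgOn P A f) ≤ Φ f := by
  refine le_of_forall_pos_le_add fun ε hε => ?_
  obtain ⟨δ₁, hδ₁, h₁⟩ := hΦ.continuous f hf (ε / 2) (half_pos hε)
  obtain ⟨δ₂, hδ₂, h₂⟩ := hΦ.continuous _ (memLp_avgOn hA hf) (ε / 2) (half_pos hε)
  set C := 1 + (P.real A)⁻¹ with hC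
  have hC0 : 0 < C := by positivity
  obtain ⟨s, hs⟩ := exists_simpleFunc_eLpNorm_sub_le hf (lt_min hδ₁ (div_pos hδ₂ hC0))
  have hsp : MemLp s p P := s.memLp_of_isFiniteMeasure p P
  have e₁ := h₁ s hsp (hs.trans (ENNReal.ofReal_le_ofReal (min_le_left _ _)))
  have e₂ := h₂ _ (memLp_avgOn hA hsp) (by
    rw [← avgOn_sub (hf.integrable Fact.out) (hsp.integrable Fact.out)]
    refine (eLpNorm_avgOn_le hA (hsp.sub hf)).trans ?_
    calc ENNReal.ofReal C * eLpNorm (⇑s - f) p P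
        ≤ ENNReal.ofReal C * ENNReal.ofReal (δ₂ / C) := by
          gcongr
          exact hs.trans (ENNReal.ofReal_le_ofReal (min_le_right _ _))
      _ = ENNReal.ofReal δ₂ := by
          rw [← ENNReal.ofReal_mul hC0.le]
          congr 1
          field_simp)
  have e₃ := hΦ.avgOn_simpleFunc_le hP s hA
  rw [abs_le] at e₁ e₂
  linarith [e₁.2, e₂.1]

/-- The conditional expectation of `f` given the discrete random variable `κ`, with the value zero
on null fibres of `κ`. -/
noncomputable def condAvg (P : Measure Ω) (κ : Ω → ℕ) (f : Ω → ℝ) (ω : Ω) : ℝ :=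
  ⨍ x in κ ⁻¹' {κ ω}, f x ∂P

theorem IsLawInvariantConvex.condAvg_le [IsProbabilityMeasure P] (hP : IsNonatomic P)
    [Fact (1 ≤ p)] {Φ : (Ω → ℝ) → ℝ} (hΦ : IsLawInvariantConvex P p Φ) {f : Ω → ℝ}
    (hf : MemLp f p P) {κ : Ω → ℕ} (hκ : Measurable κ) {m : ℕ} (hm : ∀ ω, κ ω < m) :
    MemLp (condAvg P κ f) p P ∧ Φ (condAvg P κ f) ≤ Φ f := by
  have key : ∀ n : ℕ, MemLp (fun ω => if κ ω < n then condAvg P κ f ω else f ω) p P ∧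
      Φ (fun ω => if κ ω < n then condAvg P κ f ω else f ω) ≤ Φ f := by
    intro n
    induction n with
    | zero => simpa using hf
    | succ n ih =>
      have hA : MeasurableSet (κ ⁻¹' {n}) := hκ (measurableSet_singleton n)
      have e : (fun ω => if κ ω < n + 1 then condAvg P κ f ω else f ω)
          = avgOn P (κ ⁻¹' {n}) fun ω => if κ ω < n then condAvg P κ f ω else f ω := by
        ext ω
        by_cases h : κ ω = n
        · rw [avgOn_of_mem (A := κ ⁻¹' {n}) h, if_pos (by omega), condAvg, h, setAverage_eq,
            setAverage_eq, setIntegral_congr_fun hA]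
          intro ω' hω'
          have : κ ω' = n := hω'
          simp [this]
        · rw [avgOn_of_notMem (A := κ ⁻¹' {n}) h]
          have : κ ω < n + 1 ↔ κ ω < n := by omega
          simp only [this]
      rw [e]
      exact ⟨memLp_avgOn hA ih.1, (hΦ.avgOn_le hP ih.1 hA).trans ih.2⟩
  simpa [hm] using key m

/-! ### Countermonotone copies of discrete random variables -/

theorem exists_quantile [IsProbabilityMeasure P] {Y : Ω → ℝ} (hY : Measurable Y) {c : ℝ≥0∞}
    (hc0 : 0 < c) (hc1 : c < 1) : ∃ t, P {ω | t < Y ω} ≤ c ∧ c ≤ P {ω | t ≤ Y ω} := by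
  have hmeas : ∀ t, MeasurableSet {ω | t < Y ω} := fun t => measurableSet_lt measurable_const hY
  have hanti : ∀ {s t : ℝ}, s ≤ t → {ω | t < Y ω} ⊆ {ω | s < Y ω} :=
    fun h ω hω => lt_of_le_of_lt h hω
  let S : Set ℝ := {t | P {ω | t < Y ω} ≤ c}
  have hne : S.Nonempty := by
    have h1 : P (⋂ n : ℕ, {ω | (n : ℝ) < Y ω}) = ⨅ n : ℕ, P {ω | (n : ℝ) < Y ω} :=
      Antitone.measure_iInter (fun m n h => hanti (Nat.cast_le.2 h))
        (fun n => (hmeas n).nullMeasurableSet) ⟨0, measure_ne_top _ _⟩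
    have h2 : (⋂ n : ℕ, {ω | (n : ℝ) < Y ω}) = ∅ := by
      refine Set.eq_empty_of_forall_notMem fun ω hω => ?_
      obtain ⟨n, hn⟩ := exists_nat_gt (Y ω)
      exact lt_asymm hn (Set.mem_iInter.1 hω n)
    rw [h2, measure_empty] at h1
    obtain ⟨n, hn⟩ := iInf_lt_iff.1 (h1 ▸ hc0)
    exact ⟨n, hn.le⟩
  have hbdd : BddBelow S := by
    have h1 : P (⋃ n : ℕ, {ω | -(n : ℝ) < Y ω}) = ⨆ n : ℕ, P {ω | -(n : ℝ) < Y ω} :=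
      Monotone.measure_iUnion fun m n h => hanti (neg_le_neg (Nat.cast_le.2 h))
    have h2 : (⋃ n : ℕ, {ω | -(n : ℝ) < Y ω}) = Set.univ := by
      refine Set.eq_univ_of_forall fun ω => ?_
      obtain ⟨n, hn⟩ := exists_nat_gt (-Y ω)
      exact Set.mem_iUnion.2 ⟨n, neg_lt.1 hn⟩
    rw [h2, measure_univ] at h1
    obtain ⟨n, hn⟩ := lt_iSup_iff.1 (h1 ▸ hc1)
    refine ⟨-n, fun t ht => ?_⟩
    by_contra h
    exact absurd (hn.trans_le ((measure_mono (hanti (not_le.1 h).le)).trans ht)) (lt_irrefl _)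
  have hpos : ∀ n : ℕ, (0 : ℝ) < 1 / (n + 1) := fun n => Nat.one_div_pos_of_nat
  refine ⟨sInf S, ?_, ?_⟩
  · have h1 : {ω | sInf S < Y ω} = ⋃ n : ℕ, {ω | sInf S + 1 / (n + 1) < Y ω} := by
      ext ω
      simp only [Set.mem_ofPred_eq, Set.mem_iUnion]
      refine ⟨fun h => ?_, fun ⟨n, hn⟩ => lt_trans (lt_add_of_pos_right _ (hpos n)) hn⟩
      obtain ⟨n, hn⟩ := exists_nat_one_div_lt (sub_pos.2 h)
      exact ⟨n, by linarith⟩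
    rw [h1, Monotone.measure_iUnion fun m n h => hanti (by gcongr)]
    refine iSup_le fun n => ?_
    obtain ⟨t, ht, htn⟩ := exists_lt_of_csInf_lt hne (lt_add_of_pos_right (sInf S) (hpos n))
    exact (measure_mono (hanti htn.le)).trans ht
  · have h1 : {ω | sInf S ≤ Y ω} = ⋂ n : ℕ, {ω | sInf S - 1 / (n + 1) < Y ω} := by
      ext ω
      simp only [Set.mem_ofPred_eq, Set.mem_iInter]
      refine ⟨fun h n => lt_of_lt_of_le (sub_lt_self _ (hpos n)) h, fun h => ?_⟩
      by_contra h'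
      obtain ⟨n, hn⟩ := exists_nat_one_div_lt (sub_pos.2 (not_le.1 h'))
      have := h n
      linarith
    rw [h1, Antitone.measure_iInter (fun m n h => hanti (by gcongr))
      (fun n => (hmeas _).nullMeasurableSet) ⟨0, measure_ne_top _ _⟩]
    refine le_iInf fun n => ?_
    by_contra h
    exact absurd (csInf_le hbdd (not_le.1 h).le) (not_le.2 (sub_lt_self _ (hpos n)))

/-- `A` consists of the points where `Y` is largest; ties are split arbitrarily. -/
def IsUpperFor (Y : Ω → ℝ) (A : Set Ω) : Prop := ∀ ω ∈ A, ∀ ω' ∉ A, Y ω' ≤ Y ω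

theorem IsUpperFor.exists_superset [IsProbabilityMeasure P] (hP : IsNonatomic P) {Y : Ω → ℝ}
    (hY : Measurable Y) {A : Set Ω} (hA : MeasurableSet A) (hYA : IsUpperFor Y A) {c : ℝ≥0∞}
    (hAc : P A ≤ c) (hc : c ≤ 1) :
    ∃ B, MeasurableSet B ∧ IsUpperFor Y B ∧ A ⊆ B ∧ P B = c := by
  rcases hAc.eq_or_lt with rfl | hAc'
  · exact ⟨A, hA, hYA, subset_rfl, rfl⟩
  rcases hc.eq_or_lt with rfl | hc'
  · exact ⟨Set.univ, MeasurableSet.univ, fun _ _ ω' h => absurd (Set.mem_univ ω') h,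
      Set.subset_univ A, measure_univ⟩
  obtain ⟨t, ht1, ht2⟩ := exists_quantile (P := P) hY (bot_le.trans_lt hAc') hc'
  -- a point of `A` below the level `t` would force all of `{t ≤ Y}` into `A`, which is too small
  have hA2 : A ⊆ {ω | t ≤ Y ω} := by
    intro ω hω
    by_contra h
    have h1 : {ω | t ≤ Y ω} ⊆ A := by
      intro ω' hω'
      by_contra h'
      exact h (le_trans hω' (hYA ω hω ω' h'))
    exact absurd (ht2.trans (measure_mono h1)) (not_le.2 hAc')
  have h1 : P ({ω | t < Y ω} ∪ A) ≤ c := by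
    by_cases hA3 : A ⊆ {ω | t < Y ω}
    · rwa [Set.union_eq_left.2 hA3]
    · obtain ⟨ω, hω, hωt⟩ := Set.not_subset.1 hA3
      rw [Set.union_eq_right.2]
      · exact hAc
      · intro ω' hω'
        by_contra h'
        exact hωt (lt_of_lt_of_le hω' (hYA ω hω ω' h'))
  obtain ⟨B, hB, hB1, hB2, hBc⟩ := hP.exists_between_measure_eq
    ((measurableSet_lt measurable_const hY).union hA) (measurableSet_le measurable_const hY)
    (Set.union_subset (fun ω (hω : t < Y ω) => hω.le) hA2) h1 ht2
  refine ⟨B, hB, fun ω hω ω' hω' => le_trans ?_ (hB2 hω), Set.subset_union_right.trans hB1, hBc⟩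
  exact not_lt.1 fun h => hω' (hB1 (Or.inl h))

/-- On a nonatomic space, every bounded `ℕ`-valued random variable `κ` has a copy, with the same
distribution, that is countermonotone with the given random variable `Y`. -/
theorem exists_countermonotone_copy [IsProbabilityMeasure P] (hP : IsNonatomic P) {Y : Ω → ℝ}
    (hY : Measurable Y) {κ : Ω → ℕ} (hκ : Measurable κ) {m : ℕ} (hm : ∀ ω, κ ω < m) :
    ∃ κ' : Ω → ℕ, Measurable κ' ∧ (∀ ω, κ' ω < m) ∧ IdentDistrib κ κ' P P ∧
      ∀ k, IsUpperFor Y {ω | κ' ω < k} := by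
  classical
  let S := {A : Set Ω // MeasurableSet A ∧ IsUpperFor Y A}
  let c : ℕ → ℝ≥0∞ := fun n => P {ω | κ ω ≤ n}
  have hcm : Monotone c := fun a b h => measure_mono fun ω (hω : κ ω ≤ a) => hω.trans h
  have step : ∀ (n : ℕ) (A : S), ∃ B : S, P A.1 ≤ c n → A.1 ⊆ B.1 ∧ P B.1 = c n := by
    rintro n ⟨A, hA, hYA⟩
    by_cases h : P A ≤ c n
    · obtain ⟨B, hB, hYB, hAB, hBc⟩ := hYA.exists_superset hP hY hA h prob_le_one
      exact ⟨⟨B, hB, hYB⟩, fun _ => ⟨hAB, hBc⟩⟩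
    · exact ⟨⟨A, hA, hYA⟩, fun h' => absurd h' h⟩
  choose next hnext using step
  let C : ℕ → S := fun n => Nat.rec (next 0 ⟨∅, MeasurableSet.empty, fun _ h => absurd h (by simp)⟩)
    (fun n A => next (n + 1) A) n
  have hC : ∀ n, P (C n).1 = c n := by
    intro n
    induction n with
    | zero => exact (hnext 0 _ (by simp)).2
    | succ n ih => exact (hnext (n + 1) (C n) (ih.trans_le (hcm n.le_succ))).2
  have hCm : ∀ n, (C n).1 ⊆ (C (n + 1)).1 := fun n =>
    (hnext (n + 1) (C n) ((hC n).trans_le (hcm n.le_succ))).1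
  -- from the index `m - 1` on, these sets have full measure and are replaced by the whole space
  let D : ℕ → Set Ω := fun n => if m ≤ n + 1 then Set.univ else (C n).1
  have hDmono : Monotone D := by
    refine monotone_nat_of_le_succ fun n => ?_
    by_cases h : m ≤ n + 1 + 1
    · simp [D, h]
    · have h' : ¬ m ≤ n + 1 := by omega
      simp only [D, h, h', if_false]
      exact hCm n
  have hDmeas : ∀ n, MeasurableSet (D n) := by
    intro n
    by_cases h : m ≤ n + 1
    · simp [D, h]
    · simp only [D, h, if_false]
      exact (C n).2.1
  have hDP : ∀ n, P (D n) = c n := by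
    intro n
    by_cases h : m ≤ n + 1
    · have : {ω | κ ω ≤ n} = Set.univ := Set.eq_univ_of_forall fun ω => by
        have := hm ω
        simp only [Set.mem_ofPred_eq]
        omega
      simp [D, h, c, this]
    · simp only [D, h, if_false]
      exact hC n
  have hDup : ∀ n, IsUpperFor Y (D n) := by
    intro n
    by_cases h : m ≤ n + 1
    · intro ω _ ω' hω'
      simp [D, h] at hω'
    · simp only [D, h, if_false]
      exact (C n).2.2
  have hex : ∀ ω, ∃ n, ω ∈ D n := fun ω => ⟨m, by simp [D]⟩
  let κ' : Ω → ℕ := fun ω => Nat.find (hex ω)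
  have hκ' : ∀ ω n, κ' ω ≤ n ↔ ω ∈ D n := by
    intro ω n
    rw [Nat.find_le_iff]
    exact ⟨fun ⟨k, hk, h⟩ => hDmono hk h, fun h => ⟨n, le_rfl, h⟩⟩
  have hpre : ∀ n, κ' ⁻¹' Set.Iic n = D n := fun n => Set.ext fun ω => hκ' ω n
  have hmeas : Measurable κ' := measurable_of_Iic fun n => by rw [hpre]; exact hDmeas n
  refine ⟨κ', hmeas, fun ω => ?_, ⟨hκ.aemeasurable, hmeas.aemeasurable, ?_⟩, fun k => ?_⟩
  · have h0 : 0 < m := Nat.zero_lt_of_lt (hm ω)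
    have : κ' ω ≤ m - 1 := by
      rw [hκ']
      have : m ≤ m - 1 + 1 := by omega
      simp [D, this]
    omega
  · have := Measure.isFiniteMeasure_map P κ
    refine Measure.ext_of_Iic _ _ fun n => ?_
    rw [Measure.map_apply hκ measurableSet_Iic, Measure.map_apply hmeas measurableSet_Iic, hpre,
      hDP]
    rfl
  · cases k with
    | zero => intro ω hω; exact absurd hω (by simp)
    | succ k =>
      have : {ω | κ' ω < k + 1} = D k := by
        rw [← hpre]
        ext ω
        simp
      rw [this]
      exact hDup k

/-! ### Weighted majorization -/

/-- The theorem of Hardy, Littlewood and Pólya for weighted sums. If the weighted partial sums of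
`y` dominate those of the decreasing sequence `x`, with equality for the complete sums, then `x` is
reached from `y` by finitely many transfers of weight from an entry `i` to an entry `j` that is not
larger after the transfer. Each transfer makes one more entry of `y` agree with that of `x`. -/
theorem mem_of_transfers {m : ℕ} {w x : ℕ → ℝ} (hw : ∀ i, 0 ≤ w i)
    (hx : ∀ i j, i ≤ j → j < m → x j ≤ x i) {C : Set (ℕ → ℝ)}
    (hnull : ∀ y ∈ C, ∀ y' : ℕ → ℝ, (∀ i < m, w i ≠ 0 → y' i = y i) → y' ∈ C)
    (htransfer : ∀ y ∈ C, ∀ i j δ, i < j → j < m → 0 ≤ δ → 0 < w i → 0 < w j →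
      y j + δ / w j ≤ y i - δ / w i →
        Function.update (Function.update y i (y i - δ / w i)) j (y j + δ / w j) ∈ C)
    {y : ℕ → ℝ} (hy : y ∈ C)
    (hle : ∀ k ≤ m, 0 ≤ ∑ i ∈ Finset.range k, w i * (y i - x i))
    (heq : ∑ i ∈ Finset.range m, w i * (y i - x i) = 0) : x ∈ C := by
  induction hN : ((Finset.range m).filter fun i => w i * (y i - x i) ≠ 0).card
    using Nat.strong_induction_on generalizing y with
  | _ N ih =>
  set e : ℕ → ℝ := fun i => w i * (y i - x i) with he
  by_cases hneg : ∃ j, j < m ∧ e j < 0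
  swap
  · push Not at hneg
    have h0 := (Finset.sum_eq_zero_iff_of_nonneg fun i hi => hneg i (Finset.mem_range.1 hi)).1 heq
    refine hnull y hy x fun i hi hwi => ?_
    have := h0 i (Finset.mem_range.2 hi)
    rcases mul_eq_zero.1 this with h | h
    · exact absurd h hwi
    · linarith
  classical
  -- `j` is the first negative index and `i` the last positive one before it
  obtain ⟨hjm, hej⟩ := Nat.find_spec hneg
  have hjmin : ∀ k < Nat.find hneg, 0 ≤ e k := fun k hk =>
    not_lt.1 fun h => Nat.find_min hneg hk ⟨hk.trans hjm, h⟩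
  generalize Nat.find hneg = j at hjm hej hjmin
  have hSj : 0 < ∑ k ∈ Finset.range j, e k := by
    have := hle (j + 1) hjm
    rw [Finset.sum_range_succ] at this
    linarith
  have hpos : ((Finset.range j).filter fun k => 0 < e k).Nonempty := by
    obtain ⟨k, hk, hk0⟩ := Finset.exists_lt_of_sum_lt (f := fun _ => (0 : ℝ)) (g := e)
      (s := Finset.range j) (by simpa using hSj)
    exact ⟨k, Finset.mem_filter.2 ⟨hk, hk0⟩⟩
  obtain ⟨i, hi, himax⟩ := Finset.exists_max_image _ id hpos
  obtain ⟨hij, hei⟩ := Finset.mem_filter.1 hi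
  rw [Finset.mem_range] at hij
  have hbetween : ∀ k, i < k → k < j → e k = 0 := by
    intro k hik hkj
    refine le_antisymm (not_lt.1 fun h => ?_) (hjmin k hkj)
    exact absurd (himax k (Finset.mem_filter.2 ⟨Finset.mem_range.2 hkj, h⟩)) (not_le.2 hik)
  have hwi : 0 < w i := lt_of_le_of_ne (hw i) fun h => by simp [he, ← h] at hei
  have hwj : 0 < w j := lt_of_le_of_ne (hw j) fun h => by simp [he, ← h] at hej
  set δ := min (e i) (-e j) with hδ
  have hδ0 : 0 < δ := lt_min hei (neg_pos.2 hej)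
  have hδi : δ ≤ e i := min_le_left _ _
  have hδj : δ ≤ -e j := min_le_right _ _
  set y' : ℕ → ℝ := Function.update (Function.update y i (y i - δ / w i)) j (y j + δ / w j) with hy'
  have hyi : y' i = y i - δ / w i := by
    rw [hy', Function.update_of_ne hij.ne, Function.update_self]
  have hyj : y' j = y j + δ / w j := Function.update_self _ _ _
  have hyk : ∀ k, k ≠ i → k ≠ j → y' k = y k := fun k h1 h2 => by
    rw [hy', Function.update_of_ne h2, Function.update_of_ne h1]
  have hy'C : y' ∈ C := by
    refine htransfer y hy i j δ hij hjm hδ0.le hwi hwj ?_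
    have h1 : δ / w i ≤ y i - x i := by
      rw [div_le_iff₀ hwi, mul_comm]
      exact hδi
    have h2 : δ / w j ≤ x j - y j := by
      rw [div_le_iff₀ hwj]
      have : e j = w j * (y j - x j) := rfl
      linarith
    have h3 := hx i j hij.le hjm
    linarith
  have hei' : w i * (y' i - x i) = e i - δ := by
    rw [hyi, he]
    field_simp
    ring
  have hej' : w j * (y' j - x j) = e j + δ := by
    rw [hyj, he]
    field_simp
    ring
  have he' : ∀ k, w k * (y' k - x k)
      = e k - (if k = i then δ else 0) + (if k = j then δ else 0) := by
    intro k
    by_cases h1 : k = i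
    · subst h1
      rw [hei']
      simp [hij.ne]
    · by_cases h2 : k = j
      · subst h2
        rw [hej']
        simp [h1]
      · rw [hyk k h1 h2]
        simp [h1, h2, he]
  have hsum : ∀ k, ∑ l ∈ Finset.range k, w l * (y' l - x l)
      = ∑ l ∈ Finset.range k, e l - (if i < k then δ else 0) + (if j < k then δ else 0) := by
    intro k
    simp only [he', Finset.sum_add_distrib, Finset.sum_sub_distrib, Finset.sum_ite_eq',
      Finset.mem_range]
  refine ih _ ?_ hy'C (fun k hk => ?_) ?_ rfl
  · rw [← hN]
    refine Finset.card_lt_card (Finset.ssubset_iff_subset_ne.2 ⟨fun k hk => ?_, fun h => ?_⟩)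
    · obtain ⟨hkm, hk0⟩ := Finset.mem_filter.1 hk
      refine Finset.mem_filter.2 ⟨hkm, ?_⟩
      by_cases h1 : k = i
      · subst h1; exact hei.ne'
      · by_cases h2 : k = j
        · subst h2; exact hej.ne
        · rwa [hyk k h1 h2] at hk0
    · have hi' : i ∈ (Finset.range m).filter fun k => w k * (y' k - x k) ≠ 0 := by
        rw [h]
        exact Finset.mem_filter.2 ⟨Finset.mem_range.2 (hij.trans hjm), hei.ne'⟩
      have hj' : j ∈ (Finset.range m).filter fun k => w k * (y' k - x k) ≠ 0 := by
        rw [h]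
        exact Finset.mem_filter.2 ⟨Finset.mem_range.2 hjm, hej.ne⟩
      have h1 := (Finset.mem_filter.1 hi').2
      have h2 := (Finset.mem_filter.1 hj').2
      rw [hei'] at h1
      rw [hej'] at h2
      rcases min_choice (e i) (-e j) with h3 | h3
      · exact h1 (by rw [hδ, h3, sub_self])
      · exact h2 (by rw [hδ, h3, add_neg_cancel])
  · rw [hsum]
    have hk0 := hle k hk
    by_cases h1 : j < k
    · rw [if_pos h1, if_pos (hij.trans h1)]
      linarith
    · rw [if_neg h1]
      by_cases h2 : i < k
      · rw [if_pos h2]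
        have h3 : ∑ l ∈ Finset.Ico (i + 1) k, e l = 0 := Finset.sum_eq_zero fun l hl => by
          rw [Finset.mem_Ico] at hl
          exact hbetween l (by omega) (by omega)
        have h4 := Finset.sum_range_add_sum_Ico e (show i + 1 ≤ k from h2)
        rw [h3, Finset.sum_range_succ] at h4
        have h5 := hle i (hij.trans hjm).le
        linarith
      · rw [if_neg h2]
        linarith
  · rw [hsum, if_pos (hij.trans hjm), if_pos hjm]
    linarith

/-! ### Monotonicity in the convex order -/

open Classical in
/-- A functional on `L^p` as a functional on functions, extended by zero. -/
noncomputable def onFun (F : Lp ℝ p P → ℝ) (f : Ω → ℝ) : ℝ :=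
  if h : MemLp f p P then F (h.toLp f) else 0

theorem onFun_of_memLp (F : Lp ℝ p P → ℝ) {f : Ω → ℝ} (h : MemLp f p P) :
    onFun F f = F (h.toLp f) := dif_pos h

theorem onFun_coe (F : Lp ℝ p P → ℝ) (X : Lp ℝ p P) : onFun F X = F X := by
  rw [onFun_of_memLp F (Lp.memLp X), Lp.toLp_coeFn]

theorem isLawInvariantConvex_onFun [Fact (1 ≤ p)] {F : Lp ℝ p P → ℝ}
    (hconv : ConvexOn ℝ Set.univ F) (hcont : Continuous F)
    (hlaw : ∀ X Y : Lp ℝ p P, IdentDistrib X Y P P → F X = F Y) :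
    IsLawInvariantConvex P p (onFun F) where
  convexOn := by
    refine ⟨fun f hf g hg a b _ _ _ => (hf.const_smul a).add (hg.const_smul b),
      fun f hf g hg a b ha hb hab => ?_⟩
    have h : MemLp (a • f + b • g) p P := (hf.const_smul a).add (hg.const_smul b)
    rw [onFun_of_memLp F h, onFun_of_memLp F hf, onFun_of_memLp F hg]
    exact hconv.2 (Set.mem_univ (hf.toLp f)) (Set.mem_univ (hg.toLp g)) ha hb hab
  law_invariant := by
    intro f g hf hfg
    have hg : MemLp g p P := hfg.memLp_snd hf
    rw [onFun_of_memLp F hf, onFun_of_memLp F hg]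
    refine hlaw _ _ (((IdentDistrib.of_ae_eq ?_ hf.coeFn_toLp).trans hfg).trans
      (IdentDistrib.of_ae_eq hg.aestronglyMeasurable.aemeasurable hg.coeFn_toLp.symm))
    exact (Lp.aestronglyMeasurable _).aemeasurable
  continuous := by
    intro f hf ε hε
    obtain ⟨δ, hδ, h⟩ := Metric.continuous_iff.1 hcont (hf.toLp f) ε hε
    refine ⟨δ / 2, half_pos hδ, fun g hg hgf => ?_⟩
    rw [onFun_of_memLp F hf, onFun_of_memLp F hg, ← Real.dist_eq]
    refine (h _ ?_).le
    rw [dist_eq_norm, ← MemLp.toLp_sub, Lp.norm_toLp]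
    calc (eLpNorm (g - f) p P).toReal ≤ δ / 2 := ENNReal.toReal_le_of_le_ofReal (by positivity) hgf
      _ < δ := half_lt_self hδ

/-- Conditional expectations are contractions of the `L^p` norm, since this norm is itself a
law-invariant convex functional. -/
theorem eLpNorm_condAvg_le [IsProbabilityMeasure P] (hP : IsNonatomic P) [Fact (1 ≤ p)]
    {f : Ω → ℝ} (hf : MemLp f p P) {κ : Ω → ℕ} (hκ : Measurable κ) {m : ℕ}
    (hm : ∀ ω, κ ω < m) : eLpNorm (condAvg P κ f) p P ≤ eLpNorm f p P := by
  have hnorm : IsLawInvariantConvex P p (onFun fun X : Lp ℝ p P => ‖X‖) :=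
    isLawInvariantConvex_onFun (convexOn_norm convex_univ) continuous_norm fun X Y h => by
      rw [Lp.norm_def, Lp.norm_def, h.eLpNorm_eq]
  obtain ⟨h1, h2⟩ := hnorm.condAvg_le hP hf hκ hm
  rw [onFun_of_memLp _ h1, onFun_of_memLp _ hf, Lp.norm_toLp, Lp.norm_toLp] at h2
  exact (ENNReal.toReal_le_toReal h1.eLpNorm_ne_top hf.eLpNorm_ne_top).1 h2

theorem ae_measureReal_fiber_ne_zero (P : Measure Ω) [IsFiniteMeasure P] (κ : Ω → ℕ) :
    ∀ᵐ ω ∂P, P.real (κ ⁻¹' {κ ω}) ≠ 0 := by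
  have hnull : ∀ᵐ ω ∂P, ∀ n, P (κ ⁻¹' {n}) = 0 → κ ω ≠ n := by
    refine ae_all_iff.2 fun n => ?_
    by_cases h : P (κ ⁻¹' {n}) = 0
    · filter_upwards [measure_eq_zero_iff_ae_notMem.1 h] with ω hω _ using hω
    · exact Filter.Eventually.of_forall fun ω h' => absurd h' h
  filter_upwards [hnull] with ω hω h
  exact hω (κ ω) ((measureReal_eq_zero_iff (measure_ne_top _ _)).1 h) rfl

theorem condAvg_comp_ae_eq [IsFiniteMeasure P] {κ : Ω → ℕ} (hκ : Measurable κ) (v : ℕ → ℝ)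
    {f : Ω → ℝ} (hf : Integrable f P) (hv : Integrable (fun ω => v (κ ω)) P) :
    condAvg P κ (fun ω => f ω - v (κ ω)) =ᵐ[P] fun ω => condAvg P κ f ω - v (κ ω) := by
  filter_upwards [ae_measureReal_fiber_ne_zero P κ] with ω h0
  have h1 : ∫ x in κ ⁻¹' {κ ω}, v (κ x) ∂P = P.real (κ ⁻¹' {κ ω}) * v (κ ω) := by
    rw [setIntegral_congr_fun (g := fun _ => v (κ ω)) (hκ (measurableSet_singleton _)),
      setIntegral_const, smul_eq_mul]
    intro x hx
    have : κ x = κ ω := hx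
    simp [this]
  rw [condAvg, condAvg, setAverage_eq, setAverage_eq, integral_sub hf.integrableOn hv.integrableOn,
    h1, smul_eq_mul, smul_eq_mul, mul_sub, inv_mul_cancel_left₀ h0]

theorem memLp_comp_of_lt [IsFiniteMeasure P] {κ : Ω → ℕ} (hκ : Measurable κ) {m : ℕ}
    (hm : ∀ ω, κ ω < m) (v : ℕ → ℝ) : MemLp (fun ω => v (κ ω)) p P := by
  refine MemLp.of_bound (C := ∑ i ∈ Finset.range m, |v i|)
    ((measurable_from_nat (f := v)).comp hκ).aestronglyMeasurable
    (Filter.Eventually.of_forall fun ω => ?_)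
  exact Finset.single_le_sum (f := fun i => |v i|) (fun i _ => abs_nonneg _)
    (Finset.mem_range.2 (hm ω))

/-- Every `X` in `L^p` is approximated by its conditional expectations given discrete random
variables `κ`. The values of `κ` can be numbered such that the conditional means decrease. -/
theorem exists_condAvg_eLpNorm_sub_le [IsProbabilityMeasure P] (hP : IsNonatomic P)
    [Fact (1 ≤ p)] {f : Ω → ℝ} (hf : MemLp f p P) {ε : ℝ} (hε : 0 < ε) :
    ∃ (m : ℕ) (κ : Ω → ℕ), Measurable κ ∧ (∀ ω, κ ω < m) ∧
      (∀ i j, i ≤ j → j < m → ⨍ x in κ ⁻¹' {j}, f x ∂P ≤ ⨍ x in κ ⁻¹' {i}, f x ∂P) ∧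
      eLpNorm (condAvg P κ f - f) p P ≤ ENNReal.ofReal ε := by
  obtain ⟨s, hs⟩ := exists_simpleFunc_eLpNorm_sub_le hf (half_pos hε)
  let e : s.range ≃ Fin s.range.card := s.range.equivFin
  let a : Fin s.range.card → ℝ := fun i => ⨍ x in s ⁻¹' {(e.symm i : ℝ)}, f x ∂P
  let σ : Equiv.Perm (Fin s.range.card) := Tuple.sort fun i => -a i
  have hσ : Antitone fun i => a (σ i) := fun i j hij =>
    neg_le_neg_iff.1 (Tuple.monotone_sort (fun i => -a i) hij)
  let idx : Ω → Fin s.range.card := fun ω => σ.symm (e ⟨s ω, s.mem_range_self ω⟩)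
  let κ : Ω → ℕ := fun ω => idx ω
  have hs_eq : ∀ ω, s ω = e.symm (σ (idx ω)) := by
    intro ω
    simp [idx]
  have hfib : ∀ i : Fin s.range.card, κ ⁻¹' {(i : ℕ)} = s ⁻¹' {(e.symm (σ i) : ℝ)} := by
    intro i
    ext ω
    simp only [Set.mem_preimage, Set.mem_singleton_iff, hs_eq ω, κ, Fin.val_inj,
      Subtype.val_inj, EmbeddingLike.apply_eq_iff_eq]
  have hlt : ∀ ω, κ ω < s.range.card := fun ω => (idx ω).2
  have hκ : Measurable κ := by
    refine measurable_to_countable fun ω => ?_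
    change MeasurableSet (κ ⁻¹' {((idx ω : Fin s.range.card) : ℕ)})
    rw [hfib]
    exact s.measurableSet_preimage _
  refine ⟨s.range.card, κ, hκ, hlt, fun i j hij hj => ?_, ?_⟩
  · have hi : i < s.range.card := hij.trans_lt hj
    have h1 := hfib ⟨i, hi⟩
    have h2 := hfib ⟨j, hj⟩
    simp only at h1 h2
    rw [h1, h2]
    exact hσ (show (⟨i, hi⟩ : Fin s.range.card) ≤ ⟨j, hj⟩ from hij)
  · let v : ℕ → ℝ := fun i => if h : i < s.range.card then e.symm (σ ⟨i, h⟩) else 0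
    have hv : (s : Ω → ℝ) = fun ω => v (κ ω) := by
      ext ω
      simp only [v, hlt ω, dif_pos]
      exact hs_eq ω
    have hsp : MemLp s p P := s.memLp_of_isFiniteMeasure p P
    have hfs : MemLp (f - ⇑s) p P := hf.sub hsp
    have h1 : eLpNorm (condAvg P κ f - ⇑s) p P ≤ ENNReal.ofReal (ε / 2) := by
      have h2 : condAvg P κ (f - ⇑s) =ᵐ[P] condAvg P κ f - ⇑s := by
        have := condAvg_comp_ae_eq hκ v (hf.integrable Fact.out)
          ((memLp_comp_of_lt hκ hlt v).integrable (q := 1) le_rfl)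
        rw [hv]
        exact this
      rw [← eLpNorm_congr_ae h2]
      refine (eLpNorm_condAvg_le hP hfs hκ hlt).trans ?_
      rwa [eLpNorm_sub_comm]
    have hc : MemLp (condAvg P κ f) p P :=
      memLp_comp_of_lt hκ hlt fun i => ⨍ x in κ ⁻¹' {i}, f x ∂P
    have h3 : condAvg P κ f - f = (condAvg P κ f - ⇑s) + (⇑s - f) := by abel
    rw [h3]
    refine (eLpNorm_add_le (hc.sub hsp).aestronglyMeasurable (hsp.sub hf).aestronglyMeasurable
      Fact.out).trans ?_
    calc _ ≤ ENNReal.ofReal (ε / 2) + ENNReal.ofReal (ε / 2) := add_le_add h1 hs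
      _ = ENNReal.ofReal ε := by
        rw [← ENNReal.ofReal_add (by positivity) (by positivity), add_halves]

theorem sum_measureReal_mul_average [IsFiniteMeasure P] {κ : Ω → ℕ} (hκ : Measurable κ)
    {f : Ω → ℝ} (hf : Integrable f P) (k : ℕ) :
    ∑ i ∈ Finset.range k, P.real (κ ⁻¹' {i}) * ⨍ x in κ ⁻¹' {i}, f x ∂P
      = ∫ x in {ω | κ ω < k}, f x ∂P := by
  induction k with
  | zero => simp
  | succ k ih =>
    have h1 : {ω | κ ω < k + 1} = {ω | κ ω < k} ∪ κ ⁻¹' {k} := by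
      ext ω
      simp only [Set.mem_union, Set.mem_ofPred_eq, Set.mem_preimage, Set.mem_singleton_iff]
      omega
    have h2 : Disjoint {ω | κ ω < k} (κ ⁻¹' {k}) := Set.disjoint_left.2 fun ω h h' => by
      simp only [Set.mem_ofPred_eq, Set.mem_preimage, Set.mem_singleton_iff] at h h'
      omega
    rw [Finset.sum_range_succ, ih, h1, setIntegral_union h2 (hκ (measurableSet_singleton k))
      hf.integrableOn hf.integrableOn]
    congr 1
    exact measure_smul_setAverage _ (measure_ne_top P _)

/-- A transfer of weight between two values of a discrete random variable lowers a law-invariant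
convex functional: the result is a mixture of the random variable and its average over the two
fibres. -/
theorem IsLawInvariantConvex.transfer_le [IsProbabilityMeasure P] (hP : IsNonatomic P)
    [Fact (1 ≤ p)] {Φ : (Ω → ℝ) → ℝ} (hΦ : IsLawInvariantConvex P p Φ) {κ : Ω → ℕ}
    (hκ : Measurable κ) {m : ℕ} (hm : ∀ ω, κ ω < m) (y : ℕ → ℝ) {i j : ℕ} (hij : i ≠ j) {δ : ℝ}
    (hδ : 0 ≤ δ) (hwi : 0 < P.real (κ ⁻¹' {i})) (hwj : 0 < P.real (κ ⁻¹' {j}))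
    (hle : y j + δ / P.real (κ ⁻¹' {j}) ≤ y i - δ / P.real (κ ⁻¹' {i})) :
    Φ (fun ω => Function.update (Function.update y i (y i - δ / P.real (κ ⁻¹' {i}))) j
      (y j + δ / P.real (κ ⁻¹' {j})) (κ ω)) ≤ Φ fun ω => y (κ ω) := by
  set wi := P.real (κ ⁻¹' {i}) with hwi'
  set wj := P.real (κ ⁻¹' {j}) with hwj'
  rcases hδ.eq_or_lt with rfl | hδ
  · simp
  have hyp : ∀ v : ℕ → ℝ, MemLp (fun ω => v (κ ω)) p P := memLp_comp_of_lt hκ hm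
  have hmi : MeasurableSet (κ ⁻¹' {i}) := hκ (measurableSet_singleton i)
  have hmj : MeasurableSet (κ ⁻¹' {j}) := hκ (measurableSet_singleton j)
  set A := κ ⁻¹' {i} ∪ κ ⁻¹' {j} with hAdef
  have hA : MeasurableSet A := hmi.union hmj
  have hd : Disjoint (κ ⁻¹' {i}) (κ ⁻¹' {j}) := Set.disjoint_left.2 fun ω h h' => by
    simp only [Set.mem_preimage, Set.mem_singleton_iff] at h h'
    exact hij (h.symm.trans h')
  have hfib : ∀ k, ∫ x in κ ⁻¹' {k}, y (κ x) ∂P = P.real (κ ⁻¹' {k}) * y k := by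
    intro k
    rw [setIntegral_congr_fun (g := fun _ => y k) (hκ (measurableSet_singleton k)),
      setIntegral_const, smul_eq_mul]
    intro x hx
    have : κ x = k := hx
    simp [this]
  have hi : Integrable (fun ω => y (κ ω)) P := (hyp y).integrable Fact.out
  have havg : ⨍ x in A, y (κ x) ∂P = (wi * y i + wj * y j) / (wi + wj) := by
    rw [setAverage_eq, hAdef, setIntegral_union hd hmj hi.integrableOn hi.integrableOn, hfib, hfib,
      measureReal_union hd hmj, smul_eq_mul, ← hwi', ← hwj']
    field_simp
  have hgap : 0 < y i - y j := by
    have h1 : 0 < δ / wi := by positivity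
    have h2 : 0 < δ / wj := by positivity
    linarith
  -- the full average transfers the weight `wi * wj * (y i - y j) / (wi + wj)`
  have hne : y i - y j ≠ 0 := hgap.ne'
  set l := δ * (wi + wj) / (wi * wj * (y i - y j)) with hl
  have hl0 : 0 ≤ l := by positivity
  have hl1 : l ≤ 1 := by
    rw [hl, div_le_one (by positivity)]
    have h1 : δ / wi + δ / wj ≤ y i - y j := by linarith
    have h2 : δ / wi + δ / wj = δ * (wi + wj) / (wi * wj) := by
      field_simp
      ring
    rw [h2, div_le_iff₀ (by positivity)] at h1
    linarith
  have hmix : (fun ω => Function.update (Function.update y i (y i - δ / wi)) j (y j + δ / wj) (κ ω))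
      = (1 - l) • (fun ω => y (κ ω)) + l • avgOn P A fun ω => y (κ ω) := by
    ext ω
    simp only [Pi.add_apply, Pi.smul_apply, smul_eq_mul]
    by_cases h1 : κ ω = j
    · rw [avgOn_of_mem (A := A) (Or.inr h1), havg, h1, Function.update_self, hl]
      field_simp
      ring
    · by_cases h2 : κ ω = i
      · rw [avgOn_of_mem (A := A) (Or.inl h2), havg, h2, Function.update_of_ne hij,
          Function.update_self, hl]
        field_simp
        ring
      · rw [avgOn_of_notMem (A := A) (by rintro (h | h); exacts [h2 h, h1 h]),
          Function.update_of_ne h1, Function.update_of_ne h2]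
        ring
  rw [hmix]
  have h1 := hΦ.convexOn.2 (hyp y) (memLp_avgOn hA (hyp y)) (sub_nonneg.2 hl1) hl0 (by ring)
  have h2 := hΦ.avgOn_le hP (hyp y) hA
  rw [smul_eq_mul, smul_eq_mul] at h1
  nlinarith

/-- If `X` is dominated by `Y` in the stop-loss order, then its integral over any set `A` is at most
that of `Y` over an equally likely set `B` where `Y` is largest. The stop-loss inequality is used at
the level of `Y` that separates `B` from its complement. -/
theorem setIntegral_le_of_isUpperFor [IsProbabilityMeasure P] {X Y : Ω → ℝ}
    (hX : Integrable X P) (hY : Integrable Y P) (hE : ∫ ω, X ω ∂P = ∫ ω, Y ω ∂P)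
    (hXY : ∀ t, ∫ ω, max (X ω - t) 0 ∂P ≤ ∫ ω, max (Y ω - t) 0 ∂P) {A B : Set Ω}
    (hA : MeasurableSet A) (hB : MeasurableSet B) (hAB : P A = P B) (hup : IsUpperFor Y B) :
    ∫ ω in A, X ω ∂P ≤ ∫ ω in B, Y ω ∂P := by
  rcases B.eq_empty_or_nonempty with rfl | hB1
  · rw [measure_empty] at hAB
    rw [setIntegral_measure_zero _ hAB, setIntegral_empty]
  rcases Bᶜ.eq_empty_or_nonempty with hB2 | ⟨ω₁, hω₁⟩
  · rw [Set.compl_empty_iff] at hB2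
    rw [hB2, measure_univ, prob_compl_eq_zero_iff hA |>.symm] at hAB
    rw [hB2, setIntegral_univ, ← hE, ← integral_add_compl hA hX, setIntegral_measure_zero _ hAB,
      add_zero]
  set t := sInf (Y '' B) with ht
  have hbdd : BddBelow (Y '' B) := by
    refine ⟨Y ω₁, ?_⟩
    rintro _ ⟨ω, hω, rfl⟩
    exact hup ω hω ω₁ hω₁
  have ht1 : ∀ ω ∈ B, t ≤ Y ω := fun ω hω => csInf_le hbdd ⟨ω, hω, rfl⟩
  have ht2 : ∀ ω ∉ B, Y ω ≤ t := by
    intro ω' hω'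
    refine le_csInf (hB1.image Y) ?_
    rintro _ ⟨ω, hω, rfl⟩
    exact hup ω hω ω' hω'
  have hXt : Integrable (fun ω => X ω - t) P := hX.sub (integrable_const t)
  have hYt : Integrable (fun ω => Y ω - t) P := hY.sub (integrable_const t)
  have e1 : ∫ ω in A, (X ω - t) ∂P = ∫ ω in A, X ω ∂P - P.real A * t := by
    rw [integral_sub hX.integrableOn (integrable_const t), setIntegral_const, smul_eq_mul]
  have e2 : ∫ ω in B, (Y ω - t) ∂P = ∫ ω in B, Y ω ∂P - P.real B * t := by
    rw [integral_sub hY.integrableOn (integrable_const t), setIntegral_const, smul_eq_mul]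
  have e3 : ∫ ω in A, (X ω - t) ∂P ≤ ∫ ω, max (X ω - t) 0 ∂P :=
    calc ∫ ω in A, (X ω - t) ∂P ≤ ∫ ω in A, max (X ω - t) 0 ∂P :=
          setIntegral_mono hXt.integrableOn hXt.pos_part.integrableOn fun ω => le_max_left _ _
      _ ≤ ∫ ω, max (X ω - t) 0 ∂P :=
          setIntegral_le_integral hXt.pos_part
            (Filter.Eventually.of_forall fun _ => le_max_right _ _)
  have e4 : ∫ ω, max (Y ω - t) 0 ∂P = ∫ ω in B, (Y ω - t) ∂P := by
    rw [← integral_indicator hB]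
    congr 1
    ext ω
    by_cases h : ω ∈ B
    · rw [Set.indicator_of_mem h, max_eq_left (sub_nonneg.2 (ht1 ω h))]
    · rw [Set.indicator_of_notMem h, max_eq_right (sub_nonpos.2 (ht2 ω h))]
  have e5 : P.real A = P.real B := by rw [measureReal_def, hAB, measureReal_def]
  have := hXY t
  rw [e4, e2] at this
  rw [e1] at e3
  rw [e5] at e3
  linarith

/-- Law-invariant convex functionals are monotone in the convex order. -/
theorem IsLawInvariantConvex.le_of_convexLe [IsProbabilityMeasure P] (hP : IsNonatomic P)
    [Fact (1 ≤ p)] {Φ : (Ω → ℝ) → ℝ} (hΦ : IsLawInvariantConvex P p Φ) {X Y : Lp ℝ p P}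
    (hXY : ConvexLe X Y) : Φ X ≤ Φ Y := by
  have hXp := Lp.memLp X
  have hYp := Lp.memLp Y
  have hX : Integrable X P := hXp.integrable Fact.out
  have hY : Integrable Y P := hYp.integrable Fact.out
  have hloss : ∀ t, ∫ ω, max (X ω - t) 0 ∂P ≤ ∫ ω, max (Y ω - t) 0 ∂P := by
    intro t
    refine (hXY.1 (fun z => max (z - t) 0) (fun a b h => by dsimp only; gcongr) ?_ ?_).2
    · refine ConvexOn.sup ?_ (convexOn_const 0 convex_univ)
      exact (convexOn_id convex_univ).sub (concaveOn_const t convex_univ)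
    · exact (hY.sub (integrable_const t)).pos_part
  refine le_of_forall_pos_le_add fun ε hε => ?_
  obtain ⟨δ, hδ, hcont⟩ := hΦ.continuous X hXp ε hε
  obtain ⟨m, κ, hκ, hm, hx, hclose⟩ := exists_condAvg_eLpNorm_sub_le hP hXp hδ
  obtain ⟨κ', hκ', hm', hlaw, hup⟩ :=
    exists_countermonotone_copy hP (Lp.stronglyMeasurable Y).measurable hκ hm
  let x : ℕ → ℝ := fun i => ⨍ ω in κ ⁻¹' {i}, X ω ∂P
  let y : ℕ → ℝ := fun i => ⨍ ω in κ' ⁻¹' {i}, Y ω ∂P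
  let w : ℕ → ℝ := fun i => P.real (κ' ⁻¹' {i})
  have hw : ∀ i, P.real (κ ⁻¹' {i}) = w i := fun i => by
    change (P (κ ⁻¹' {i})).toReal = (P (κ' ⁻¹' {i})).toReal
    rw [hlaw.measure_mem_eq (measurableSet_singleton i)]
  have hsum : ∀ k, ∑ i ∈ Finset.range k, w i * (y i - x i)
      = ∫ ω in {ω | κ' ω < k}, Y ω ∂P - ∫ ω in {ω | κ ω < k}, X ω ∂P := by
    intro k
    simp only [mul_sub, Finset.sum_sub_distrib]
    rw [← sum_measureReal_mul_average hκ' hY k, ← sum_measureReal_mul_average hκ hX k]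
    simp only [hw, w, x, y]
  have hcx : ∀ v : ℕ → ℝ, MemLp (fun ω => v (κ' ω)) p P := memLp_comp_of_lt hκ' hm'
  have hmajor : x ∈ {v : ℕ → ℝ | Φ (fun ω => v (κ' ω)) ≤ Φ Y} := by
    refine mem_of_transfers (m := m) (w := w) (y := y) (fun i => measureReal_nonneg) hx ?_ ?_ ?_
      (fun k _ => ?_) ?_
    · intro v hv v' hv'
      refine le_trans (hΦ.congr_ae (hcx v') ?_).le hv
      filter_upwards [ae_measureReal_fiber_ne_zero P κ'] with ω hω
      exact hv' _ (hm' ω) hω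
    · intro v hv i j d hij _ hd hwi hwj hle
      exact (hΦ.transfer_le hP hκ' hm' v hij.ne hd hwi hwj hle).trans hv
    · exact (hΦ.condAvg_le hP hYp hκ' hm').2
    · rw [hsum]
      exact sub_nonneg.2 (setIntegral_le_of_isUpperFor hX hY hXY.2 hloss
        (hκ (measurableSet_Iio (a := k))) (hκ' (measurableSet_Iio (a := k)))
        (hlaw.measure_mem_eq measurableSet_Iio) (hup k))
    · have h1 : {ω | κ ω < m} = Set.univ := Set.eq_univ_of_forall hm
      have h2 : {ω | κ' ω < m} = Set.univ := Set.eq_univ_of_forall hm'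
      rw [hsum, h1, h2, setIntegral_univ, setIntegral_univ]
      exact sub_eq_zero.2 hXY.2.symm
  have hcopy : Φ (condAvg P κ X) = Φ fun ω => x (κ' ω) :=
    hΦ.law_invariant _ _ (memLp_comp_of_lt hκ hm x) (hlaw.comp (measurable_from_nat (f := x)))
  have h1 := abs_le.1 (hcont _ (memLp_comp_of_lt hκ hm x) hclose)
  have h2 : Φ (fun ω => x (κ' ω)) ≤ Φ Y := hmajor
  have h3 : Φ (condAvg P κ X) = Φ fun ω => x (κ ω) := rfl
  linarith [h1.1]

/-! ### Expectation and centering on `L^p` -/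

theorem integrable_coe [IsProbabilityMeasure P] [Fact (1 ≤ p)] (X : Lp ℝ p P) :
    Integrable X P :=
  (Lp.memLp X).integrable Fact.out

theorem expect_add [IsProbabilityMeasure P] [Fact (1 ≤ p)] (X Y : Lp ℝ p P) :
    expect (X + Y) = expect X + expect Y := by
  rw [expect, integral_congr_ae (Lp.coeFn_add X Y)]
  exact integral_add (integrable_coe X) (integrable_coe Y)

theorem expect_smul (l : ℝ) (X : Lp ℝ p P) : expect (l • X) = l * expect X := by
  rw [expect, integral_congr_ae (Lp.coeFn_smul l X)]
  exact integral_const_mul l _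

theorem expect_const [IsProbabilityMeasure P] (c : ℝ) : expect (Lp.const p P c) = c := by
  rw [expect, integral_congr_ae (Lp.coeFn_const p P c)]
  simp

theorem abs_expect_le [IsProbabilityMeasure P] [Fact (1 ≤ p)] (X : Lp ℝ p P) : |expect X| ≤ ‖X‖ :=
  calc |expect X| ≤ ∫ ω, ‖X ω‖ ∂P := norm_integral_le_integral_norm (X : Ω → ℝ)
    _ = (eLpNorm X 1 P).toReal := by
      rw [integral_norm_eq_lintegral_enorm (Lp.aestronglyMeasurable X),
        eLpNorm_one_eq_lintegral_enorm]
    _ ≤ (eLpNorm X p P).toReal := ENNReal.toReal_mono (Lp.eLpNorm_ne_top X)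
      (eLpNorm_le_eLpNorm_of_exponent_le Fact.out (Lp.aestronglyMeasurable X))
    _ = ‖X‖ := (Lp.norm_def X).symm

theorem continuous_expect [IsProbabilityMeasure P] [Fact (1 ≤ p)] :
    Continuous (expect : Lp ℝ p P → ℝ) := by
  let E : Lp ℝ p P →ₗ[ℝ] ℝ :=
    { toFun := expect, map_add' := expect_add, map_smul' := expect_smul }
  exact (E.mkContinuous 1 fun X => by rw [one_mul]; exact abs_expect_le X).continuous

theorem continuous_const_Lp [IsFiniteMeasure P] [Fact (1 ≤ p)] :
    Continuous fun c : ℝ => Lp.const p P c :=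
  (Lp.constL p P ℝ : ℝ →L[ℝ] Lp ℝ p P).continuous

theorem smul_const_Lp [IsFiniteMeasure P] (l c : ℝ) : l • Lp.const p P c = Lp.const p P (l * c) :=
  ((Lp.constₗ p P ℝ : ℝ →ₗ[ℝ] Lp ℝ p P).map_smul l c).symm

/-- The deviation `X - E[X]` of `X` from its mean. -/
noncomputable def center [IsFiniteMeasure P] (X : Lp ℝ p P) : Lp ℝ p P :=
  X - Lp.const p P (expect X)

theorem center_add_const_expect [IsFiniteMeasure P] (X : Lp ℝ p P) :
    center X + Lp.const p P (expect X) = X :=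
  sub_add_cancel _ _

theorem center_add [IsProbabilityMeasure P] [Fact (1 ≤ p)] (X Y : Lp ℝ p P) :
    center (X + Y) = center X + center Y := by
  simp only [center, expect_add, map_add]
  abel

theorem center_smul [IsFiniteMeasure P] (l : ℝ) (X : Lp ℝ p P) : center (l • X) = l • center X := by
  rw [center, center, expect_smul, smul_sub, smul_const_Lp]

theorem center_const [IsProbabilityMeasure P] (c : ℝ) : center (Lp.const p P c) = 0 := by
  rw [center, expect_const, sub_self]

theorem expect_center [IsProbabilityMeasure P] [Fact (1 ≤ p)] (X : Lp ℝ p P) :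
    expect (center X) = 0 := by
  have h := congrArg expect (center_add_const_expect X)
  rw [expect_add, expect_const] at h
  linarith

theorem isConstant_iff_center_eq_zero [IsProbabilityMeasure P] {X : Lp ℝ p P} :
    IsConstant X ↔ center X = 0 := by
  refine ⟨?_, fun h => ⟨expect X, sub_eq_zero.1 h⟩⟩
  rintro ⟨c, rfl⟩
  exact center_const c

theorem center_of_expect_eq_zero [IsFiniteMeasure P] {X : Lp ℝ p P} (h : expect X = 0) :
    center X = X := by
  rw [center, h, map_zero, sub_zero]

theorem continuous_center [IsProbabilityMeasure P] [Fact (1 ≤ p)] :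
    Continuous (center : Lp ℝ p P → Lp ℝ p P) :=
  continuous_id.sub (continuous_const_Lp.comp continuous_expect)

theorem exists_expect_eq_zero_ne_zero [IsProbabilityMeasure P] [Fact (1 ≤ p)] (hP : IsNonatomic P) :
    ∃ Z : Lp ℝ p P, expect Z = 0 ∧ Z ≠ 0 := by
  obtain ⟨B, hB, -, hB0, hB1⟩ := hP Set.univ MeasurableSet.univ (by simp)
  rw [measure_univ] at hB1
  let X : Lp ℝ p P := indicatorConstLp p hB (measure_ne_top P B) (1 : ℝ)
  refine ⟨center X, expect_center X, fun h => ?_⟩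
  obtain ⟨c, hc⟩ := isConstant_iff_center_eq_zero.2 h
  have h1 : B.indicator (fun _ => (1 : ℝ)) =ᵐ[P] fun _ => c := by
    have h2 : (X : Ω → ℝ) =ᵐ[P] fun _ => c := by
      rw [hc]
      exact Lp.coeFn_const _ _ _
    exact (indicatorConstLp_coeFn.symm).trans h2
  rcases eq_or_ne c 1 with rfl | hc1
  · have h2 : P Bᶜ = 0 := by
      refine measure_eq_zero_iff_ae_notMem.2 ?_
      filter_upwards [h1] with ω hω h3
      simp [Set.indicator_of_notMem h3] at hω
    rw [prob_compl_eq_zero_iff hB] at h2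
    exact hB1.ne h2
  · refine hB0.ne' (measure_eq_zero_iff_ae_notMem.2 ?_)
    filter_upwards [h1] with ω hω h3
    rw [Set.indicator_of_mem h3] at hω
    exact hc1 hω.symm

theorem convexLe_of_identDistrib {X Y : Lp ℝ p P} (h : IdentDistrib X Y P P) : ConvexLe X Y := by
  refine ⟨fun u hu _ hY => ?_, h.integral_eq⟩
  have hcomp : IdentDistrib (fun ω => u (X ω)) (fun ω => u (Y ω)) P P := h.comp hu.measurable
  exact ⟨hcomp.integrable_iff.2 hY, hcomp.integral_eq.le⟩

theorem continuous_of_isClosed_Iic_Ici {α β : Type*} [TopologicalSpace α] [TopologicalSpace β]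
    [LinearOrder β] [OrderTopology β] {f : α → β} (h₁ : ∀ b, IsClosed {a | f a ≤ b})
    (h₂ : ∀ b, IsClosed {a | b ≤ f a}) : Continuous f := by
  refine continuous_iff_lower_upperSemicontinuous.2 ⟨?_, ?_⟩
  · exact lowerSemicontinuous_iff_isClosed_preimage.2 h₁
  · exact upperSemicontinuous_iff_isClosed_preimage.2 h₂

/-! ### Mean-deviation functionals satisfy the axioms -/

theorem IsLawInvariantDeviation.coe_smul [IsFiniteMeasure P] {D : Lp ℝ p P → ℝ≥0}
    (hD : IsLawInvariantDeviation D) (X : Lp ℝ p P) {l : ℝ} (hl : 0 ≤ l) :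
    (D (l • X) : ℝ) = l * D X := by
  lift l to ℝ≥0 using hl
  rw [hD.smul, NNReal.coe_mul]

theorem axioms_of_meanDeviation [IsProbabilityMeasure P] (hP : IsNonatomic P) [Fact (1 ≤ p)]
    {R : Lp ℝ p P → Lp ℝ p P → Prop} {D : Lp ℝ p P → ℝ≥0} {g : ℝ≥0 → ℝ}
    (hD : IsLawInvariantDeviation D) (hDc : Continuous D) (hg : Continuous g) (hgm : StrictMono g)
    (hrep : Represents (meanDeviation g D) R) :
    MonotoneOnConstants R ∧ TranslationInvariant R ∧ WeaklyPosHomogeneous R ∧ RiskAverse R ∧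
      Solvable R ∧ WeaklyConvex R ∧ ContinuousPref R := by
  have hD0 : ∀ c, D (Lp.const p P c) = 0 := by
    intro c
    have h1 := hD.smul 0 0
    have h2 := hD.add_const 0 c
    simp only [NNReal.coe_zero, zero_smul, zero_mul] at h1
    rw [zero_add, h1] at h2
    exact h2
  have hsame : ∀ {X Y}, expect X = expect Y → (R X Y ↔ D X ≤ D Y) := by
    intro X Y h
    rw [hrep, meanDeviation, meanDeviation, h, add_le_add_iff_right, hgm.le_iff_le]
  have hΦ : IsLawInvariantConvex P p (onFun fun X : Lp ℝ p P => (D X : ℝ)) := by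
    refine isLawInvariantConvex_onFun ⟨convex_univ, fun X _ Y _ a b ha hb _ => ?_⟩
      (NNReal.continuous_coe.comp hDc) fun X Y h => congrArg _ (hD.law_invariant X Y h)
    rw [smul_eq_mul, smul_eq_mul, ← hD.coe_smul X ha, ← hD.coe_smul Y hb]
    exact_mod_cast hD.add_le (a • X) (b • Y)
  have hcont : Continuous (meanDeviation g D) := (hg.comp hDc).add continuous_expect
  refine ⟨fun c₁ c₂ h => ?_, fun c X Y => ?_, fun X Y hE h l hl => ?_, ⟨fun X Y h => ?_,
    fun X hX => ?_⟩, fun X => ?_, fun X Y hE h l hl0 hl1 => ?_, fun X => ⟨?_, ?_⟩⟩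
  · rw [hrep, meanDeviation, meanDeviation, hD0, hD0, expect_const, expect_const]
    linarith
  · simp only [hrep _ _, meanDeviation, hD.add_const, expect_add]
    constructor <;> intro h <;> linarith
  · rw [hsame hE] at h
    rw [hsame (by rw [expect_smul, expect_smul, hE])]
    rw [← NNReal.coe_le_coe, hD.coe_smul X hl.le, hD.coe_smul Y hl.le]
    gcongr
  · rw [hsame h.2]
    have h1 := hΦ.le_of_convexLe hP h
    rw [onFun_coe, onFun_coe] at h1
    exact_mod_cast h1
  · rw [StrictPref, hsame (expect_const _), hsame (expect_const _).symm, hD0]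
    exact ⟨bot_le, not_le.2 (hD.pos X hX)⟩
  · refine ⟨g (D X) + expect X - g 0, ?_⟩
    rw [Indiff, hrep, hrep, meanDeviation, meanDeviation, hD0, expect_const]
    constructor <;> linarith
  · have hXY : D Y ≤ D X := (hsame hE.symm).1 h.2
    rw [hsame (by rw [expect_add, expect_smul, expect_smul, hE]; ring)]
    have h4 : (D (l • X + (1 - l) • Y) : ℝ) ≤ l * D X + (1 - l) * D Y := by
      rw [← hD.coe_smul X hl0, ← hD.coe_smul Y (sub_nonneg.2 hl1)]
      exact_mod_cast hD.add_le (l • X) ((1 - l) • Y)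
    have h5 : (D Y : ℝ) ≤ D X := by exact_mod_cast hXY
    have h6 : (D (l • X + (1 - l) • Y) : ℝ) ≤ D X := by nlinarith
    exact_mod_cast h6
  · simp only [hrep _ _]
    exact isClosed_le hcont continuous_const
  · simp only [hrep _ _]
    exact isClosed_le continuous_const hcont

/-! ### Preferences that satisfy the axioms are mean-deviation preferences -/

/-- Monotonicity on constants is strict. Otherwise translation-invariance makes all constants
indifferent, and a nonconstant random variable, which is indifferent to some constant, is
indifferent to its mean. -/
theorem not_pref_const_of_lt [IsFiniteMeasure P] {R : Lp ℝ p P → Lp ℝ p P → Prop}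
    (hR : IsPreference R) (hmono : MonotoneOnConstants R) (htrans : TranslationInvariant R)
    (hrisk : RiskAverse R) (hsolv : Solvable R) {Z : Lp ℝ p P} (hZ : ¬ IsConstant Z) {a b : ℝ}
    (hab : a < b) : ¬ R (Lp.const p P b) (Lp.const p P a) := by
  intro h
  have hstep : ∀ c, R (Lp.const p P (c + (b - a))) (Lp.const p P c) := by
    intro c
    have h1 := (htrans (c - a) _ _).1 h
    rw [← map_add, ← map_add] at h1
    convert h1 using 2 <;> ring
  have hn : ∀ (c : ℝ) (n : ℕ), R (Lp.const p P (c + n * (b - a))) (Lp.const p P c) := by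
    intro c n
    induction n with
    | zero => simpa using hR.refl _
    | succ n ih =>
      refine hR.trans _ _ _ ?_ ih
      convert hstep (c + n * (b - a)) using 2
      push_cast
      ring
  have hall : ∀ c d, R (Lp.const p P c) (Lp.const p P d) := by
    intro c d
    obtain ⟨n, hn'⟩ := exists_nat_gt ((c - d) / (b - a))
    rw [div_lt_iff₀ (sub_pos.2 hab)] at hn'
    exact hR.trans _ _ _ (hmono c _ (by linarith)) (hn d n)
  obtain ⟨c, hc, -⟩ := hsolv Z
  exact (hrisk.2 Z hZ).2 (hR.trans _ _ _ hc (hall _ _))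

/-- A nonconstant random variable with mean zero is not weakly preferred to zero. -/
theorem not_pref_zero [IsProbabilityMeasure P] {R : Lp ℝ p P → Lp ℝ p P → Prop}
    (hrisk : RiskAverse R) {X : Lp ℝ p P} (hX : expect X = 0) (hX0 : X ≠ 0) : ¬ R X 0 := by
  have h := (hrisk.2 X fun h => hX0 ?_).2
  · rwa [hX, map_zero] at h
  · rwa [isConstant_iff_center_eq_zero, center_of_expect_eq_zero hX] at h

/-- If `t • Z` were weakly preferred to the smaller multiple `s • Z`, then by homogeneity `Z` would
be weakly preferred to all `(s / t) ^ n • Z`, and hence to their limit zero. -/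
theorem not_pref_smul_of_lt [IsProbabilityMeasure P] [Fact (1 ≤ p)]
    {R : Lp ℝ p P → Lp ℝ p P → Prop} (hR : IsPreference R) (hhom : WeaklyPosHomogeneous R)
    (hrisk : RiskAverse R) (hcont : ContinuousPref R) {Z : Lp ℝ p P} (hZ : expect Z = 0)
    (hZ0 : Z ≠ 0) {s t : ℝ} (hs : 0 ≤ s) (hst : s < t) : ¬ R (t • Z) (s • Z) := by
  intro h
  have ht : 0 < t := hs.trans_lt hst
  have hE : ∀ l : ℝ, expect (l • Z) = 0 := fun l => by rw [expect_smul, hZ, mul_zero]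
  set r := s / t with hr
  have h1 : R Z (r • Z) := by
    have := hhom _ _ (by rw [hE, hE]) h t⁻¹ (inv_pos.2 ht)
    rwa [smul_smul, smul_smul, inv_mul_cancel₀ ht.ne', one_smul, inv_mul_eq_div] at this
  have hr0 : 0 ≤ r := div_nonneg hs ht.le
  have hr1 : r < 1 := (div_lt_one ht).2 hst
  refine not_pref_zero hrisk hZ hZ0 ?_
  rcases hr0.eq_or_lt with h0 | h0
  · rwa [← h0, zero_smul] at h1
  have hpow : ∀ n : ℕ, R Z (r ^ n • Z) := by
    intro n
    induction n with
    | zero => simpa using hR.refl Z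
    | succ n ih =>
      refine hR.trans _ _ _ ih ?_
      have := hhom _ _ (by rw [hE, hZ]) h1 (r ^ n) (pow_pos h0 n)
      rwa [smul_smul, ← pow_succ] at this
  have hlim : Filter.Tendsto (fun n : ℕ => r ^ n • Z) Filter.atTop (nhds 0) := by
    simpa using (tendsto_pow_atTop_nhds_zero_of_lt_one hr0 hr1).smul_const Z
  exact (hcont Z).2.mem_of_tendsto hlim (Filter.Eventually.of_forall hpow)

/-- Every random variable with mean zero is indifferent to a multiple of `Z`, since `[0, ∞)` is
connected. -/
theorem exists_indiff_smul [IsProbabilityMeasure P] [Fact (1 ≤ p)]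
    {R : Lp ℝ p P → Lp ℝ p P → Prop} (hR : IsPreference R) (hhom : WeaklyPosHomogeneous R)
    (hrisk : RiskAverse R) (hcont : ContinuousPref R) {Z : Lp ℝ p P} (hZ : expect Z = 0)
    (hZ0 : Z ≠ 0) {X : Lp ℝ p P} (hX : expect X = 0) : ∃ t : ℝ≥0, Indiff R X ((t : ℝ) • Z) := by
  have hsm : Continuous fun t : ℝ≥0 => (t : ℝ) • Z := NNReal.continuous_coe.smul continuous_const
  have hA : IsClosed {t : ℝ≥0 | R ((t : ℝ) • Z) X} := (hcont X).1.preimage hsm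
  have hB : IsClosed {t : ℝ≥0 | R X ((t : ℝ) • Z)} := (hcont X).2.preimage hsm
  have hzero : R 0 X := by
    by_cases h : X = 0
    · rw [h]; exact hR.refl 0
    · exact (hR.total 0 X).resolve_right (not_pref_zero hrisk hX h)
  have hBne : ∃ t : ℝ≥0, R X ((t : ℝ) • Z) := by
    by_contra! hnone
    -- if all multiples of `Z` were preferred to `X`, then `Z` would be preferred to all
    -- positive multiples of `X`, and hence to zero
    refine not_pref_zero hrisk hZ hZ0 ?_
    have hn : ∀ n : ℕ, R Z ((1 / (n + 1 : ℝ)) • X) := by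
      intro n
      have hn0 : (0 : ℝ) < n + 1 := by positivity
      have h1 := (hR.total _ _).resolve_left (hnone (n + 1))
      have h2 := hhom _ _ (by rw [expect_smul, hZ, hX, mul_zero]) h1 _ (one_div_pos.2 hn0)
      rw [smul_smul] at h2
      push_cast at h2
      rwa [one_div_mul_cancel hn0.ne', one_smul] at h2
    have hlim : Filter.Tendsto (fun n : ℕ => (1 / (n + 1 : ℝ)) • X) Filter.atTop (nhds 0) := by
      simpa using (tendsto_one_div_add_atTop_nhds_zero_nat (𝕜 := ℝ)).smul_const X
    exact (hcont Z).2.mem_of_tendsto hlim (Filter.Eventually.of_forall hn)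
  obtain ⟨t, -, ht⟩ := isPreconnected_closed_iff.1 isPreconnected_univ _ _ hB hA
    (fun t _ => hR.total _ _) (hBne.imp fun t ht => ⟨Set.mem_univ t, ht⟩)
    ⟨0, Set.mem_univ _, by simpa using hzero⟩
  exact ⟨t, ht⟩

theorem exists_meanDeviation_of_axioms [IsProbabilityMeasure P] (hP : IsNonatomic P)
    [Fact (1 ≤ p)] {R : Lp ℝ p P → Lp ℝ p P → Prop} (hR : IsPreference R)
    (hmono : MonotoneOnConstants R) (htrans : TranslationInvariant R)
    (hhom : WeaklyPosHomogeneous R) (hrisk : RiskAverse R) (hsolv : Solvable R)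
    (hconv : WeaklyConvex R) (hcont : ContinuousPref R) :
    ∃ (D : Lp ℝ p P → ℝ≥0) (g : ℝ≥0 → ℝ), IsLawInvariantDeviation D ∧ Continuous D ∧
      Continuous g ∧ StrictMono g ∧ Represents (meanDeviation g D) R := by
  obtain ⟨Z, hZ, hZ0⟩ := exists_expect_eq_zero_ne_zero (p := p) hP
  have hZc : ¬ IsConstant Z := by
    rwa [isConstant_iff_center_eq_zero, center_of_expect_eq_zero hZ]
  have hEZ : ∀ l : ℝ, expect (l • Z) = 0 := fun l => by rw [expect_smul, hZ, mul_zero]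
  -- the certainty equivalent `c`
  choose c hc using hsolv
  have hconst : ∀ a b, R (Lp.const p P a) (Lp.const p P b) ↔ a ≤ b := fun a b =>
    ⟨fun h => not_lt.1 fun h' =>
      not_pref_const_of_lt hR hmono htrans hrisk (fun X => ⟨c X, hc X⟩) hZc h' h, hmono a b⟩
  have hcle : ∀ X Y, R X Y ↔ c X ≤ c Y := by
    intro X Y
    rw [← hconst]
    exact ⟨fun h => hR.trans _ _ _ (hc X).2 (hR.trans _ _ _ h (hc Y).1),
      fun h => hR.trans _ _ _ (hc X).1 (hR.trans _ _ _ h (hc Y).2)⟩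
  have hcconst : ∀ a, c (Lp.const p P a) = a := fun a =>
    le_antisymm ((hconst _ _).1 (hc _).2) ((hconst _ _).1 (hc _).1)
  have hcadd : ∀ X a, c (X + Lp.const p P a) = c X + a := by
    intro X a
    have h1 := (htrans a _ _).1 (hc X).1
    have h2 := (htrans a _ _).1 (hc X).2
    rw [← map_add, hcle, hcconst] at h1 h2
    exact le_antisymm h1 h2
  have hcindiff : ∀ {X Y}, Indiff R X Y → c X = c Y := fun h =>
    le_antisymm ((hcle _ _).1 h.1) ((hcle _ _).1 h.2)
  -- the deviation `D`: the multiple of `Z` that is indifferent to the centered random variable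
  choose D hD using fun X : Lp ℝ p P =>
    exists_indiff_smul hR hhom hrisk hcont hZ hZ0 (expect_center X)
  let g : ℝ≥0 → ℝ := fun t => c ((t : ℝ) • Z)
  have hg : StrictMono g := by
    intro s t hst
    refine not_le.1 fun h => ?_
    exact not_pref_smul_of_lt hR hhom hrisk hcont hZ hZ0 s.2 (NNReal.coe_lt_coe.2 hst)
      ((hcle _ _).2 h)
  have hcD : ∀ X, c (center X) = g (D X) := fun X => hcindiff (hD X)
  have hDle : ∀ (X) (t : ℝ≥0), D X ≤ t ↔ R (center X) ((t : ℝ) • Z) := fun X t => by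
    rw [hcle, hcD]; exact hg.le_iff_le.symm
  have hleD : ∀ (X) (t : ℝ≥0), t ≤ D X ↔ R ((t : ℝ) • Z) (center X) := fun X t => by
    rw [hcle, hcD]; exact hg.le_iff_le.symm
  have hDuniq : ∀ (X) (t : ℝ≥0), Indiff R (center X) ((t : ℝ) • Z) → D X = t := fun X t h =>
    le_antisymm ((hDle X t).2 h.1) ((hleD X t).2 h.2)
  have hDcongr : ∀ {X Y}, center X = center Y → D X = D Y := fun {X Y} h =>
    hDuniq X _ (h ▸ hD Y)
  have hD0 : ∀ X, D X = 0 → center X = 0 := by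
    intro X h
    by_contra hX
    have h1 := (hDle X 0).1 h.le
    rw [NNReal.coe_zero, zero_smul] at h1
    exact not_pref_zero hrisk (expect_center X) hX h1
  have hcX : ∀ X, c X = g (D X) + expect X := by
    intro X
    rw [← hcD, ← hcadd, center_add_const_expect]
  have hscale : ∀ X (l : ℝ≥0), 0 < l →
      Indiff R ((l : ℝ) • center X) (((l * D X : ℝ≥0) : ℝ) • Z) := by
    intro X l hl
    rw [NNReal.coe_mul, mul_smul]
    exact ⟨hhom _ _ (by rw [hEZ, expect_center]) (hD X).1 l hl,
      hhom _ _ (by rw [hEZ, expect_center]) (hD X).2 l hl⟩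
  refine ⟨D, g, ⟨fun X a => hDcongr ?_, fun X hX => ?_, fun X l => ?_, fun X Y => ?_,
    fun X Y h => ?_⟩, ?_, ?_, hg, fun X Y => ?_⟩
  · rw [center_add, center_const, add_zero]
  · exact pos_iff_ne_zero.2 fun h => hX (isConstant_iff_center_eq_zero.2 (hD0 X h))
  · rcases eq_or_ne l 0 with rfl | hl
    · refine hDuniq _ _ ?_
      rw [center_smul, zero_mul, NNReal.coe_zero, zero_smul, zero_smul]
      exact ⟨hR.refl _, hR.refl _⟩
    · refine hDuniq _ _ ?_
      rw [center_smul]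
      exact hscale X l (pos_iff_ne_zero.2 hl)
  · rcases eq_or_ne (D X) 0 with hX | hX
    · rw [hX, zero_add]
      refine (hDcongr ?_).le
      rw [center_add, hD0 X hX, zero_add]
    rcases eq_or_ne (D Y) 0 with hY | hY
    · rw [hY, add_zero]
      refine (hDcongr ?_).le
      rw [center_add, hD0 Y hY, add_zero]
    -- `X` and `Y` are rescaled to deviation one; weak convexity applies to their convex
    -- combination that is proportional to `X + Y`
    set a := D X with ha
    set b := D Y with hb
    have ha0 : (0 : ℝ) < a := NNReal.coe_pos.2 (pos_iff_ne_zero.2 hX)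
    have hb0 : (0 : ℝ) < b := NNReal.coe_pos.2 (pos_iff_ne_zero.2 hY)
    have h1 := hscale X a⁻¹ (inv_pos.2 (pos_iff_ne_zero.2 hX))
    have h2 := hscale Y b⁻¹ (inv_pos.2 (pos_iff_ne_zero.2 hY))
    rw [← ha, inv_mul_cancel₀ hX, NNReal.coe_one, one_smul, NNReal.coe_inv] at h1
    rw [← hb, inv_mul_cancel₀ hY, NNReal.coe_one, one_smul, NNReal.coe_inv] at h2
    have h3 := hconv _ _ (by rw [expect_smul, expect_smul, expect_center, expect_center, mul_zero,
      mul_zero]) ⟨hR.trans _ _ _ h1.1 h2.2, hR.trans _ _ _ h2.1 h1.2⟩ (a / (a + b)) (by positivity)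
      (by rw [div_le_one (by positivity)]; linarith)
    have h4 : ((a : ℝ) / (a + b)) • ((a : ℝ)⁻¹ • center X)
        + (1 - (a : ℝ) / (a + b)) • ((b : ℝ)⁻¹ • center Y) = ((a : ℝ) + b)⁻¹ • center (X + Y) := by
      rw [center_add, smul_add, smul_smul, smul_smul]
      congr 2 <;> field_simp
      ring
    rw [h4] at h3
    have h5 := hhom _ _ (by rw [expect_smul, expect_center, hZ, mul_zero])
      (hR.trans _ _ _ h3 h1.1) (a + b) (by positivity)
    rw [smul_smul, mul_inv_cancel₀ (by positivity), one_smul] at h5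
    rw [hDle, NNReal.coe_add]
    exact h5
  · have h1 := (hcle _ _).1 (hrisk.1 X Y (convexLe_of_identDistrib h))
    have h2 := (hcle _ _).1 (hrisk.1 Y X (convexLe_of_identDistrib h.symm))
    have h3 : expect X = expect Y := h.integral_eq
    rw [hcX, hcX, h3] at h1 h2
    exact hg.injective (le_antisymm (by linarith) (by linarith))
  · refine continuous_of_isClosed_Iic_Ici (fun t => ?_) fun t => ?_
    · simp only [hDle]
      exact (hcont _).1.preimage continuous_center
    · simp only [hleD]
      exact (hcont _).2.preimage continuous_center
  · have hsm : Continuous fun t : ℝ≥0 => (t : ℝ) • Z :=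
      NNReal.continuous_coe.smul continuous_const
    refine continuous_of_isClosed_Iic_Ici (fun a => ?_) fun a => ?_
    · have h1 : {t : ℝ≥0 | g t ≤ a} = {t : ℝ≥0 | R ((t : ℝ) • Z) (Lp.const p P a)} := by
        ext t
        simp only [Set.mem_ofPred_eq, hcle, hcconst, g]
      rw [h1]
      exact (hcont _).1.preimage hsm
    · have h1 : {t : ℝ≥0 | a ≤ g t} = {t : ℝ≥0 | R (Lp.const p P a) ((t : ℝ) • Z)} := by
        ext t
        simp only [Set.mem_ofPred_eq, hcle, hcconst, g]
      rw [h1]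
      exact (hcont _).2.preimage hsm
  · rw [hcle, hcX, hcX]
    rfl

end MeanDeviation

theorem propositionS2 {Ω : Type*} [MeasurableSpace Ω] (P : Measure Ω) [IsProbabilityMeasure P]
    (hP : MeanDeviation.IsNonatomic P) (p : ℝ≥0∞) [Fact (1 ≤ p)]
    (R : Lp ℝ p P → Lp ℝ p P → Prop) (hR : MeanDeviation.IsPreference R) :
    (MeanDeviation.MonotoneOnConstants R ∧ MeanDeviation.TranslationInvariant R ∧
      MeanDeviation.WeaklyPosHomogeneous R ∧ MeanDeviation.RiskAverse R ∧
      MeanDeviation.Solvable R ∧ MeanDeviation.WeaklyConvex R ∧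
      MeanDeviation.ContinuousPref R) ↔
    ∃ (D : Lp ℝ p P → ℝ≥0) (g : ℝ≥0 → ℝ),
      MeanDeviation.IsLawInvariantDeviation D ∧ Continuous D ∧
      Continuous g ∧ StrictMono g ∧
      MeanDeviation.Represents (MeanDeviation.meanDeviation g D) R := by
  constructor
  · rintro ⟨h1, h2, h3, h4, h5, h6, h7⟩
    exact MeanDeviation.exists_meanDeviation_of_axioms hP hR h1 h2 h3 h4 h5 h6 h7
  · rintro ⟨D, g, hD, hDc, hg, hgm, hrep⟩
    exact MeanDeviation.axioms_of_meanDeviation hP hD hDc hg hgm hrep
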